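/- Let $T=\begin{pmatrix}1&1\\0&1\end{pmatrix}$, $L=\begin{pmatrix}1&0\\1&1\end{pmatrix}$, let $\Gamma_N\subset \mathrm{SL}_2(\mathbb{Z})$ be the principal congruence subgroup of level $N$ and $\mathrm{P}\Gamma_N$ its image in $\mathrm{PSL}_2(\mathbb{Z})$; $\mathrm{P}\Gamma_6$ is normal in $\mathrm{P}\Gamma_2$. An origami is a translation surface obtained by gluing finitely many unit squares along their edges by translations. Let $X$ be the origami whose squares are labelled by the pairs $(A,h)$ with $A\in \mathrm{P}\Gamma_6\backslash \mathrm{P}\Gamma_2$ and $h\in\{1,2,3,4\}$, with horizontal gluings (right edge of a square to the left edge of its image) $$(A,1)\mapsto(A,2),\quad (A,2)\mapsto(AL^{-2},1),\quad (A,3)\mapsto(A,4),\quad (A,4)\mapsto(AL^{2},3)$$ and vertical gluings (upper edge of a square to the lower edge of its image) $$(A,1)\mapsto(AL^{2},3),\quad (A,2)\mapsto(AL^{-2},4),\quad (A,3)\mapsto(AT^{-2},1),\quad (A,4)\mapsto(AT^{2},2).$$ Let $E[2]$ be the origami with four squares $1,2,3,4$, horizontal gluings $(1\,2)(3\,4)$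 and vertical gluings $(1\,3)(2\,4)$, and let $p:X\to E[2]$ map the square $(A,h)$ to the square $h$ by a translation. Let $P,Q,S\in E[2]$ be the lower left corners of the squares $1,2,4$. For $B\in \mathrm{P}\Gamma_2/\mathrm{P}\Gamma_6$ let $\tau_B:X\to X$ map each square $(A,h)$ to the square $(BA,h)$ by a translation. An affine homeomorphism of $X$ with derivative $D\in\mathrm{SL}_2(\mathbb{R})$ is a homeomorphism of $X$ that preserves the set of singularities and is, away from them, locally of the form $v\mapsto Dv+b$ in the charts of the translation structure; the Veech group of $X$ is the group of all derivatives $D$, and $\mathrm{Trans}(X)$ is the group of the affine homeomorphisms with derivative the identity. Proposition. The origami $X$ has the following properties. (i) $X$ is a closed connected surface tiled by $48$ squares. Its genus is $13$, and it has exactly twelve singularities, all of cone angle $6\pi$: four over each of $P$, $Q$ and $S$, namely the lower left corners of the squares $(A,h)$ with $h=1$, $h=2$ and $h=4$, respectively; all other points have cone angle $2\pi$. The group of translations is $$\mathrm{Trans}(X)=\{\tau_B \mid B\in \mathrm{P}\Gamma_2/\mathrm{P}\Gamma_6\}\cong \mathrm{P}\Gamma_2/\mathrm{P}\Gamma_6,$$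 where the isomorphism is $\tau_B\leftrightarrow B$, and $\mathrm{P}\Gamma_2/\mathrm{P}\Gamma_6\cong \mathrm{PSL}_2(\mathbb{Z}/3\mathbb{Z})$. The map $p$ is locally a translation in the charts of the translation structures, and it induces an isomorphism of translation surfaces $X/\mathrm{Trans}(X)\cong E[2]$. In particular $p:X\to E[2]$, which is a covering of degree $12$ outside of $P,Q,S$, is normal (its deck transformations act transitively on each fibre), and its group of deck transformations is $\mathrm{Trans}(X)\cong\mathrm{P}\Gamma_2/\mathrm{P}\Gamma_6$. (ii) The Veech group of $X$ is $\mathrm{SL}_2(\mathbb{Z})\subset \mathrm{SL}_2(\mathbb{R})$. -/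

import Mathlib

open Topology Matrix
open scoped MatrixGroups unitInterval

noncomputable section

/-- A (not necessarily connected) origami: finitely many unit squares, glued along their edges by
translations. The right edge of the square `s` is glued to the left edge of `right s`, and the upper
edge of `s` to the lower edge of `up s`. -/
structure Origami where
  Sq : Type
  finite_sq : Finite Sq
  right : Equiv.Perm Sq
  up : Equiv.Perm Sq

namespace Origami

variable (O : Origami)

/-- The disjoint union of the closed unit squares. A point of a square is given by its two
coordinates in `[0, 1]`. -/
abbrev Squares : Type := Σ _ : O.Sq, (Fin 2 → I)

/-- The edge gluings. -/
inductive Glue : O.Squares → O.Squares → Prop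
  | right (s : O.Sq) (t : I) : Glue ⟨s, ![1, t]⟩ ⟨O.right s, ![0, t]⟩
  | up (s : O.Sq) (t : I) : Glue ⟨s, ![t, 1]⟩ ⟨O.up s, ![t, 0]⟩

/-- The surface obtained by gluing the squares, with the quotient topology (`Quot` is the quotient
by the equivalence relation generated by `Glue`). -/
def Surface : Type := Quot O.Glue

instance : TopologicalSpace O.Surface := inferInstanceAs (TopologicalSpace (Quot O.Glue))

variable {O} in
/-- The point of the surface with coordinates `p` in the square `s`. -/
def pt (s : O.Sq) (p : Fin 2 → I) : O.Surface := Quot.mk O.Glue ⟨s, p⟩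

variable {O} in
/-- The lower left corner of the square `s`. -/
def corner (s : O.Sq) : O.Surface := pt s 0

/-! ### The square tiling: Euler characteristic, genus, cone angles -/

/-- The vertices of the tiling, as points of the surface. -/
def vertices : Set O.Surface :=
  {x | ∃ (s : O.Sq) (p : Fin 2 → I), (∀ i, p i = 0 ∨ p i = 1) ∧ x = pt s p}

/-- The (closed) edges of the tiling, as subsets of the surface. -/
def edges : Set (Set O.Surface) :=
  {e | ∃ (s : O.Sq) (i : Fin 2) (c : I), (c = 0 ∨ c = 1) ∧ e = pt s '' {p | p i = c}}

/-- The (closed) faces of the tiling, as subsets of the surface. -/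
def faces : Set (Set O.Surface) :=
  {F | ∃ s : O.Sq, F = Set.range (pt s)}

/-- The Euler characteristic `V - E + F`. -/
def eulerChar : ℤ := (O.vertices.ncard : ℤ) - O.edges.ncard + O.faces.ncard

/-- The surface is connected, and its genus, determined by `χ = 2 - 2g`, is `g`. -/
def HasGenus (g : ℕ) : Prop := ConnectedSpace O.Surface ∧ O.eulerChar = 2 - 2 * (g : ℤ)

open Classical in
/-- The angle of the unit square at its point `p`: it is `2π` in the interior, `π` on an open edge
and `π / 2` at a corner. -/
def squareAngle (p : Fin 2 → I) : ℝ :=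
  2 * Real.pi * ∏ i, (if p i = 0 ∨ p i = 1 then 1 / 2 else 1)

variable {O} in
/-- The cone angle at `x`: the sum of the angles of the squares at all the points which are glued
to `x`. -/
def coneAngle (x : O.Surface) : ℝ :=
  ∑ᶠ q : {q : O.Squares // pt q.1 q.2 = x}, squareAngle q.1.2

/-! ### The translation structure -/

/-- A point of the unit square as a vector in the plane. -/
def toPlane (p : Fin 2 → I) : Fin 2 → ℝ := fun i => (p i : ℝ)

variable {O} in
/-- The charts of the translation structure: homeomorphisms from an open subset of the surface to
an open subset of the plane which on each of the squares are locally translations. -/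
def IsTranslationChart (e : OpenPartialHomeomorph O.Surface (Fin 2 → ℝ)) : Prop :=
  ∀ (s : O.Sq) (p : Fin 2 → I), pt s p ∈ e.source →
    ∀ᶠ q in 𝓝 p, e (pt s q) = e (pt s p) + (toPlane q - toPlane p)

/-- The singularities: the points which lie in the domain of no translation chart. -/
def singularities : Set O.Surface :=
  {x | ∀ e : OpenPartialHomeomorph O.Surface (Fin 2 → ℝ), IsTranslationChart e → x ∉ e.source}

variable {O} in
/-- `f` is an affine homeomorphism with derivative `A`: it preserves the set of singularities, and
away from them it has in translation charts locally the form `v ↦ A v + b`. -/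
def IsAffine (f : O.Surface ≃ₜ O.Surface) (A : SL(2, ℝ)) : Prop :=
  (∀ x, f x ∈ O.singularities ↔ x ∈ O.singularities) ∧
  ∀ e e' : OpenPartialHomeomorph O.Surface (Fin 2 → ℝ),
    IsTranslationChart e → IsTranslationChart e' → ∀ x ∈ e.source, f x ∈ e'.source →
      ∀ᶠ y in 𝓝 x, e' (f y) = e' (f x) + A.1 *ᵥ (e y - e x)

variable {O} in
theorem IsTranslationChart.eventually_eq {e e' : OpenPartialHomeomorph O.Surface (Fin 2 → ℝ)}
    (he : IsTranslationChart e) (he' : IsTranslationChart e') {x : O.Surface}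
    (hx : x ∈ e.source) (hx' : x ∈ e'.source) :
    ∀ᶠ y in 𝓝 x, e' y = e' x + (e y - e x) := by
  have hq : IsQuotientMap (fun q : O.Squares => (pt q.1 q.2 : O.Surface)) :=
    isQuotientMap_quot_mk
  -- the set of points at which `e' - e` is locally constant near `x`
  let W : Set O.Surface := {y | e' y - e y = e' x - e x}
  have hW : ∀ y ∈ (e.source ∩ e'.source) ∩ W, ∀ (s : O.Sq) (p : Fin 2 → I), pt s p = y →
      ∀ᶠ q in 𝓝 p, pt s q ∈ (e.source ∩ e'.source) ∩ W := by
    rintro y ⟨⟨h1, h2⟩, h3⟩ s p rfl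
    have hc : Continuous fun q : Fin 2 → I => (pt s q : O.Surface) :=
      hq.continuous.comp (continuous_sigmaMk)
    filter_upwards [he s p h1, he' s p h2, hc.continuousAt (e.open_source.mem_nhds h1),
      hc.continuousAt (e'.open_source.mem_nhds h2)] with q k1 k2 k3 k4
    refine ⟨⟨k3, k4⟩, ?_⟩
    change e' (pt s q) - e (pt s q) = e' x - e x
    change e' (pt s p) - e (pt s p) = e' x - e x at h3
    rw [k1, k2, ← h3]; abel
  have hopen : IsOpen ((e.source ∩ e'.source) ∩ W) := by
    rw [← hq.isOpen_preimage, isOpen_sigma_iff]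
    intro s
    rw [isOpen_iff_mem_nhds]
    intro p hp
    exact hW _ hp s p rfl
  filter_upwards [hopen.mem_nhds ⟨⟨hx, hx'⟩, rfl⟩] with y hy
  have : e' y - e y = e' x - e x := hy.2
  rw [sub_eq_iff_eq_add] at this
  rw [this]; abel

variable {O} in
theorem IsAffine.one : IsAffine (1 : O.Surface ≃ₜ O.Surface) 1 := by
  refine ⟨fun x => Iff.rfl, fun e e' he he' x hx hx' => ?_⟩
  filter_upwards [he.eventually_eq he' hx hx'] with y hy
  simpa using hy

variable {O} in
theorem IsAffine.mul {f g : O.Surface ≃ₜ O.Surface} {A B : SL(2, ℝ)} (hf : IsAffine f A)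
    (hg : IsAffine g B) : IsAffine (f * g) (A * B) := by
  refine ⟨fun x => (hf.1 (g x)).trans (hg.1 x), fun e e' he he' x hx hx' => ?_⟩
  have hreg : g x ∉ O.singularities := fun h => (hg.1 x).1 h e he hx
  simp only [singularities, Set.mem_ofPred_eq, not_forall, not_not] at hreg
  obtain ⟨e₁, he₁, hx₁⟩ := hreg
  have h1 := hg.2 e e₁ he he₁ x hx hx₁
  have h2 := g.continuous.continuousAt (hf.2 e₁ e' he₁ he' (g x) hx₁ hx')
  filter_upwards [h1, h2] with y k1 k2
  have k3 : e' (f (g y)) = e' (f (g x)) + A.1 *ᵥ (e₁ (g y) - e₁ (g x)) := k2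
  change e' (f (g y)) = e' (f (g x)) + (A * B).1 *ᵥ (e y - e x)
  rw [k3, k1, add_sub_cancel_left, Matrix.mulVec_mulVec]
  rfl

variable {O} in
theorem IsAffine.inv {f : O.Surface ≃ₜ O.Surface} {A : SL(2, ℝ)} (hf : IsAffine f A) :
    IsAffine f⁻¹ A⁻¹ := by
  have hinv : ∀ z, f (f⁻¹ z) = z := fun z => f.apply_symm_apply z
  refine ⟨fun x => ?_, fun e e' he he' x hx hx' => ?_⟩
  · rw [← hf.1, hinv]
  have h1 := hf.2 e' e he' he (f⁻¹ x) hx' (by rwa [hinv])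
  have h2 := f.symm.continuous.continuousAt h1
  filter_upwards [h2] with y k
  have k' : e (f (f⁻¹ y)) = e (f (f⁻¹ x)) + A.1 *ᵥ (e' (f⁻¹ y) - e' (f⁻¹ x)) := k
  rw [hinv, hinv] at k'
  have hA : A⁻¹.1 * A.1 = 1 := congrArg Subtype.val (inv_mul_cancel A)
  rw [k', add_sub_cancel_left, Matrix.mulVec_mulVec, hA, Matrix.one_mulVec]
  abel

/-- The group of affine homeomorphisms. -/
def affineGroup : Subgroup (O.Surface ≃ₜ O.Surface) where
  carrier := {f | ∃ A, IsAffine f A}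
  one_mem' := ⟨1, IsAffine.one⟩
  mul_mem' := fun ⟨A, hA⟩ ⟨B, hB⟩ => ⟨A * B, hA.mul hB⟩
  inv_mem' := fun ⟨A, hA⟩ => ⟨A⁻¹, hA.inv⟩

/-- The Veech group: the derivatives of the affine homeomorphisms. -/
def veechGroup : Subgroup SL(2, ℝ) where
  carrier := {A | ∃ f ∈ O.affineGroup, IsAffine f A}
  one_mem' := ⟨1, O.affineGroup.one_mem, IsAffine.one⟩
  mul_mem' := fun ⟨f, hf, hA⟩ ⟨g, hg, hB⟩ => ⟨f * g, O.affineGroup.mul_mem hf hg, hA.mul hB⟩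
  inv_mem' := fun ⟨f, hf, hA⟩ => ⟨f⁻¹, O.affineGroup.inv_mem hf, hA.inv⟩

/-- The group of translations: the affine homeomorphisms with derivative the identity. -/
def translationGroup : Subgroup (O.Surface ≃ₜ O.Surface) where
  carrier := {f | IsAffine f 1}
  one_mem' := IsAffine.one
  mul_mem' := fun hf hg => by simpa using IsAffine.mul hf hg
  inv_mem' := fun hf => by simpa using IsAffine.inv hf

/-- Two points are equivalent if a translation maps one to the other. -/
def translationSetoid : Setoid O.Surface where
  r x y := ∃ f ∈ O.translationGroup, f x = y
  iseqv :=
    { refl := fun _ => ⟨1, O.translationGroup.one_mem, rfl⟩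
      symm := by
        rintro x y ⟨f, hf, rfl⟩
        exact ⟨f⁻¹, O.translationGroup.inv_mem hf, f.symm_apply_apply x⟩
      trans := by
        rintro x y z ⟨f, hf, rfl⟩ ⟨g, hg, rfl⟩
        exact ⟨g * f, O.translationGroup.mul_mem hg hf, rfl⟩ }

/-- The quotient of the surface by its group of translations, with the quotient topology. -/
abbrev ModTranslations : Type := Quotient O.translationSetoid

/-! ### Maps between origamis -/

/-- A map which in translation charts is locally a translation. -/
def IsLocalTranslation {O O' : Origami} (f : O.Surface → O'.Surface) : Prop :=
  ∀ (e : OpenPartialHomeomorph O.Surface (Fin 2 → ℝ))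
    (e' : OpenPartialHomeomorph O'.Surface (Fin 2 → ℝ)),
    IsTranslationChart e → IsTranslationChart e' → ∀ x ∈ e.source, f x ∈ e'.source →
      ∀ᶠ y in 𝓝 x, e' (f y) = e' (f x) + (e y - e x)

/-- A map between the sets of squares which respects the gluing rules. -/
structure Hom (O O' : Origami) where
  toFun : O.Sq → O'.Sq
  map_right : ∀ s, toFun (O.right s) = O'.right (toFun s)
  map_up : ∀ s, toFun (O.up s) = O'.up (toFun s)

/-- The induced map between the surfaces, which maps each square `s` to the square `φ s` by the
identity in the coordinates of the squares. -/
def Hom.map {O O' : Origami} (φ : Hom O O') : O.Surface → O'.Surface :=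
  Quot.map (fun q => ⟨φ.toFun q.1, q.2⟩) (by
    intro a b h
    cases h with
    | right s t => exact φ.map_right s ▸ Glue.right _ _
    | up s t => exact φ.map_up s ▸ Glue.up _ _)

end Origami

/-- The group of deck transformations of a map `p`. -/
def deckGroup {S S' : Type} [TopologicalSpace S] (p : S → S') : Subgroup (S ≃ₜ S) where
  carrier := {f | ∀ x, p (f x) = p x}
  one_mem' := fun _ => rfl
  mul_mem' := fun {f g} hf hg x => (hf (g x)).trans (hg x)
  inv_mem' := by
    intro f hf x
    exact (hf (f.symm x)).symm.trans (congrArg p (f.apply_symm_apply x))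

/-! ### The group `PΓ₂ / PΓ₆` -/

/-- The image in `PSL(2, ℤ)` of the principal congruence subgroup of level `N`. -/
def PGamma (N : ℕ) : Subgroup PSL(2, ℤ) :=
  (CongruenceSubgroup.Gamma N).map (QuotientGroup.mk' (Subgroup.center SL(2, ℤ)))

instance (N : ℕ) : (PGamma N).Normal :=
  Subgroup.Normal.map (CongruenceSubgroup.Gamma_normal N) _ (QuotientGroup.mk'_surjective _)

/-- The group `PΓ₂ / PΓ₆`. -/
abbrev PGammaQuot : Type := PGamma 2 ⧸ (PGamma 6).subgroupOf (PGamma 2)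

instance : Finite PGammaQuot := by
  have h : (PGamma 6).FiniteIndex :=
    ⟨fun h0 => by
      have h1 := Subgroup.index_map_dvd (CongruenceSubgroup.Gamma 6)
        (QuotientGroup.mk'_surjective (Subgroup.center SL(2, ℤ)))
      have h2 : ((CongruenceSubgroup.Gamma 6).map
        (QuotientGroup.mk' (Subgroup.center SL(2, ℤ)))).index = 0 := h0
      rw [h2, zero_dvd_iff] at h1
      exact Subgroup.FiniteIndex.index_ne_zero h1⟩
  exact Subgroup.finite_quotient_of_finiteIndex

/-- The matrix `T = (1 1; 0 1)`. -/
def matT : SL(2, ℤ) := ⟨!![1, 1; 0, 1], by simp⟩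

/-- The matrix `L = (1 0; 1 1)`. -/
def matL : SL(2, ℤ) := ⟨!![1, 0; 1, 1], by simp⟩

theorem matT_sq_mem : matT ^ 2 ∈ CongruenceSubgroup.Gamma 2 := by
  have h : (matT ^ 2).1 = !![1, 2; 0, 1] := by
    rw [pow_two]
    change !![(1 : ℤ), 1; 0, 1] * !![1, 1; 0, 1] = _
    decide
  rw [CongruenceSubgroup.Gamma_mem]
  change (((matT ^ 2).1 0 0 : ℤ) : ZMod 2) = 1 ∧ (((matT ^ 2).1 0 1 : ℤ) : ZMod 2) = 0 ∧
    (((matT ^ 2).1 1 0 : ℤ) : ZMod 2) = 0 ∧ (((matT ^ 2).1 1 1 : ℤ) : ZMod 2) = 1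
  rw [h]
  decide

theorem matL_sq_mem : matL ^ 2 ∈ CongruenceSubgroup.Gamma 2 := by
  have h : (matL ^ 2).1 = !![1, 0; 2, 1] := by
    rw [pow_two]
    change !![(1 : ℤ), 0; 1, 1] * !![1, 0; 1, 1] = _
    decide
  rw [CongruenceSubgroup.Gamma_mem]
  change (((matL ^ 2).1 0 0 : ℤ) : ZMod 2) = 1 ∧ (((matL ^ 2).1 0 1 : ℤ) : ZMod 2) = 0 ∧
    (((matL ^ 2).1 1 0 : ℤ) : ZMod 2) = 0 ∧ (((matL ^ 2).1 1 1 : ℤ) : ZMod 2) = 1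
  rw [h]
  decide

/-- The class in `PΓ₂ / PΓ₆` of an element of `Γ₂`. -/
def toQuot (g : SL(2, ℤ)) (hg : g ∈ CongruenceSubgroup.Gamma 2) : PGammaQuot :=
  QuotientGroup.mk (⟨QuotientGroup.mk g, Subgroup.mem_map_of_mem _ hg⟩ : PGamma 2)

/-- The class of `T²`. -/
def clT2 : PGammaQuot := toQuot (matT ^ 2) matT_sq_mem

/-- The class of `L²`. -/
def clL2 : PGammaQuot := toQuot (matL ^ 2) matL_sq_mem

/-! ### The origamis `X` and `E[2]` -/

/-- The horizontal gluings of `X`. The squares are labelled by pairs `(A, h)`; the labels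
`h = 1, 2, 3, 4` are written as `0, 1, 2, 3`, and the right cosets of the normal subgroup `PΓ₆` of
`PΓ₂` are elements of the quotient group. -/
def rightX : Equiv.Perm (PGammaQuot × Fin 4) where
  toFun
    | (A, 0) => (A, 1)
    | (A, 1) => (A * clL2⁻¹, 0)
    | (A, 2) => (A, 3)
    | (A, 3) => (A * clL2, 2)
  invFun
    | (A, 0) => (A * clL2, 1)
    | (A, 1) => (A, 0)
    | (A, 2) => (A * clL2⁻¹, 3)
    | (A, 3) => (A, 2)
  left_inv := by
    rintro ⟨A, h⟩
    fin_cases h <;> simp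
  right_inv := by
    rintro ⟨A, h⟩
    fin_cases h <;> simp

/-- The vertical gluings of `X`. -/
def upX : Equiv.Perm (PGammaQuot × Fin 4) where
  toFun
    | (A, 0) => (A * clL2, 2)
    | (A, 1) => (A * clL2⁻¹, 3)
    | (A, 2) => (A * clT2⁻¹, 0)
    | (A, 3) => (A * clT2, 1)
  invFun
    | (A, 0) => (A * clT2, 2)
    | (A, 1) => (A * clT2⁻¹, 3)
    | (A, 2) => (A * clL2⁻¹, 0)
    | (A, 3) => (A * clL2, 1)
  left_inv := by
    rintro ⟨A, h⟩
    fin_cases h <;> simp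
  right_inv := by
    rintro ⟨A, h⟩
    fin_cases h <;> simp

/-- The origami `X`. -/
def origamiX : Origami where
  Sq := PGammaQuot × Fin 4
  finite_sq := inferInstance
  right := rightX
  up := upX

/-- The horizontal gluings `(1 2)(3 4)` of `E[2]`. -/
def rightE2 : Equiv.Perm (Fin 4) := Equiv.swap 0 1 * Equiv.swap 2 3

/-- The vertical gluings `(1 3)(2 4)` of `E[2]`. -/
def upE2 : Equiv.Perm (Fin 4) := Equiv.swap 0 2 * Equiv.swap 1 3

/-- The trivial `2 × 2` origami `E[2]`, with the squares `1, 2` in the lower row and `3, 4` in the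
upper row written as `0, 1, 2, 3`, and opposite edges glued. -/
def origamiE2 : Origami where
  Sq := Fin 4
  finite_sq := inferInstance
  right := rightE2
  up := upE2

/-- The covering `p : X → E[2]`, which maps the square `(A, h)` to the square `h`. -/
def coveringP : Origami.Hom origamiX origamiE2 where
  toFun := fun s => s.2
  map_right := by
    rintro ⟨A, h⟩
    match h with
    | 0 => exact (by decide : (1 : Fin 4) = rightE2 0)
    | 1 => exact (by decide : (0 : Fin 4) = rightE2 1)
    | 2 => exact (by decide : (3 : Fin 4) = rightE2 2)
    | 3 => exact (by decide : (2 : Fin 4) = rightE2 3)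
  map_up := by
    rintro ⟨A, h⟩
    match h with
    | 0 => exact (by decide : (2 : Fin 4) = upE2 0)
    | 1 => exact (by decide : (3 : Fin 4) = upE2 1)
    | 2 => exact (by decide : (0 : Fin 4) = upE2 2)
    | 3 => exact (by decide : (1 : Fin 4) = upE2 3)

/-- The map `τ_B : X → X`, which maps the square `(A, h)` to the square `(B A, h)`. -/
def tau (B : PGammaQuot) : Origami.Hom origamiX origamiX where
  toFun := fun s => (B * s.1, s.2)
  map_right := by
    rintro ⟨A, h⟩
    match h with
    | 0 => rfl
    | 1 => exact congrArg (·, (0 : Fin 4)) (mul_assoc B A clL2⁻¹).symm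
    | 2 => rfl
    | 3 => exact congrArg (·, (2 : Fin 4)) (mul_assoc B A clL2).symm
  map_up := by
    rintro ⟨A, h⟩
    match h with
    | 0 => exact congrArg (·, (2 : Fin 4)) (mul_assoc B A clL2).symm
    | 1 => exact congrArg (·, (3 : Fin 4)) (mul_assoc B A clL2⁻¹).symm
    | 2 => exact congrArg (·, (0 : Fin 4)) (mul_assoc B A clT2⁻¹).symm
    | 3 => exact congrArg (·, (1 : Fin 4)) (mul_assoc B A clT2).symm

/-- The lower left corners `P`, `Q`, `S` of the squares `1`, `2`, `4` of `E[2]`. -/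
def pointsPQS : Set origamiE2.Surface :=
  (fun h : Fin 4 => Origami.corner (O := origamiE2) h) '' {0, 1, 3}

/-- The lower left corners of the squares `(A, h)`, for all `A` and a fixed `h`. -/
def cornersX (h : Fin 4) : Set origamiX.Surface :=
  Set.range fun A : PGammaQuot => Origami.corner (O := origamiX) (A, h)

end

/-!
The coordinates modulo `1` define a projection of a surface tiled by squares to the torus
`ℝ² / ℤ²`. Its only branch points are lower left corners of squares, and such a corner is singular
if and only if the commutator of the two gluing permutations moves the square. For the squares of
`X` this commutator acts by right multiplication by an element of `PΓ₂ / PΓ₆`, which is identified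
with `PSL₂(ℤ/3)` by reduction modulo `3`; the classes of `T ^ 2` and `L ^ 2` satisfy
`t ^ 3 = l ^ 3 = (t l) ^ 2 = 1` there, so that the monodromy is trivial for `h = 3` and has order
`3` for the other `h`.

An affine homeomorphism is affine on each square after projection to the torus, and it permutes the
singularities, all of which project to `0`. If its derivative is the identity, it therefore
commutes with the projection, so it permutes the squares and commutes with the gluings. Such a
permutation is determined by the image of one square and preserves the squares with trivial
monodromy, so it is a left multiplication. For an arbitrary derivative `D`, the sides of a square
with singular corners are mapped to closed curves of the torus, so `D` is integral. Conversely, the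
quarter turn and the shear, which generate `SL₂(ℤ)`, lift to `X` because suitable permutations of
the squares intertwine the gluings.
-/

noncomputable section

namespace Origami

variable {O O' : Origami}

instance : Finite O.Sq := O.finite_sq

/-! ### Normal forms of points -/

theorem eq_vecCons {α : Type*} (p : Fin 2 → α) : p = ![p 0, p 1] :=
  (FinVec.etaExpand_eq p).symm

theorem pt_right (s : O.Sq) (t : I) : pt s ![1, t] = pt (O.right s) ![0, t] :=
  Quot.sound (Glue.right s t)

theorem pt_up (s : O.Sq) (t : I) : pt s ![t, 1] = pt (O.up s) ![t, 0] :=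
  Quot.sound (Glue.up s t)

theorem pt_surjective : Function.Surjective fun q : O.Squares => (pt q.1 q.2 : O.Surface) :=
  Quot.mk_surjective

open Classical in
/-- The representative in `[0, 1)` of `t` modulo `1`. -/
def wrap (t : I) : I := if t = 1 then 0 else t

@[simp] theorem wrap_one : wrap 1 = 0 := if_pos rfl

@[simp] theorem wrap_zero : wrap 0 = 0 := if_neg zero_ne_one

theorem wrap_of_ne {t : I} (h : t ≠ 1) : wrap t = t := if_neg h

theorem wrap_ne_one (t : I) : wrap t ≠ 1 := by
  unfold wrap
  split_ifs with h
  exacts [zero_ne_one, h]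

theorem wrap_eq_wrap_iff {a p : I} : wrap a = wrap p ↔ a = p ∨ a = 0 ∧ p = 1 ∨ a = 1 ∧ p = 0 := by
  grind [wrap]

/-- The coordinates of the point `p` of a square `s` in the square `wrapSq s p`. -/
def wrapPt (p : Fin 2 → I) : Fin 2 → I := fun i => wrap (p i)

open Classical in
/-- The square in which the point `p` of the square `s` has both coordinates in `[0, 1)`. For the
upper right corner there are two ways to reach such a square; the choice made here is to go right
first. -/
def wrapSq (s : O.Sq) (p : Fin 2 → I) : O.Sq :=
  (if p 1 = 1 then O.up else 1) ((if p 0 = 1 then O.right else 1) s)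

theorem wrapPt_of_ne {p : Fin 2 → I} (h : ∀ i, p i ≠ 1) : wrapPt p = p :=
  funext fun i => wrap_of_ne (h i)

theorem wrapPt_ne_one (p : Fin 2 → I) (i : Fin 2) : wrapPt p i ≠ 1 := wrap_ne_one _

theorem wrapSq_of_ne {s : O.Sq} {p : Fin 2 → I} (h : ∀ i, p i ≠ 1) : wrapSq s p = s := by
  simp [wrapSq, h 0, h 1]

theorem bijective_wrapSq (p : Fin 2 → I) : Function.Bijective fun s : O.Sq => wrapSq s p := by
  classical
  exact ((if p 1 = 1 then O.up else 1) * (if p 0 = 1 then O.right else 1)).bijective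

theorem pt_wrap (s : O.Sq) (p : Fin 2 → I) : pt (wrapSq s p) (wrapPt p) = pt s p := by
  rw [eq_vecCons (wrapPt p)]
  conv_rhs => rw [eq_vecCons p]
  by_cases h0 : p 0 = 1 <;> by_cases h1 : p 1 = 1
  · rw [h0, h1, pt_right, pt_up]
    simp [wrapSq, wrapPt, h0, h1]
  all_goals simp [wrapSq, wrapPt, h0, h1, wrap_of_ne, pt_up, pt_right]

theorem exists_eq_pt (x : O.Surface) : ∃ s p, (∀ i, p i ≠ 1) ∧ x = pt s p := by
  obtain ⟨⟨s, p⟩, rfl⟩ := pt_surjective x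
  exact ⟨_, _, wrapPt_ne_one p, (pt_wrap s p).symm⟩

theorem exists_pt_eq_of_wrapPt_eq {s : O.Sq} {p a : Fin 2 → I} (h : wrapPt a = wrapPt p) :
    ∃ s', (pt s' a : O.Surface) = pt s p := by
  obtain ⟨s', hs' : wrapSq s' a = wrapSq s p⟩ := (bijective_wrapSq a).2 (wrapSq s p)
  exact ⟨s', by rw [← pt_wrap s p, ← pt_wrap s' a, h, hs']⟩

/-! ### Coincidences of points -/

variable (O) in
/-- The monodromy around the lower left corners: the square reached from a given square by going
once around its lower left corner. -/
def cornerPerm : Equiv.Perm O.Sq := O.right * O.up * O.right⁻¹ * O.up⁻¹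

theorem cornerPerm_up_right (s : O.Sq) : O.cornerPerm (O.up (O.right s)) = O.right (O.up s) := by
  simp [cornerPerm]

theorem corner_cornerPerm (s : O.Sq) : corner (O.cornerPerm s) = corner s := by
  obtain ⟨s, rfl⟩ := O.up.surjective s
  obtain ⟨s, rfl⟩ := O.right.surjective s
  rw [cornerPerm_up_right, corner, corner, eq_vecCons 0]
  simp only [Pi.zero_apply, ← pt_right, ← pt_up]

theorem corner_eq_of_sameCycle {s s' : O.Sq} (h : O.cornerPerm.SameCycle s s') :
    corner s = corner s' := by
  obtain ⟨n, -, rfl⟩ := h.exists_pow_eq'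
  clear h
  induction n with
  | zero => rfl
  | succ n ih => rw [pow_succ', Equiv.Perm.mul_apply, corner_cornerPerm, ih]

/-- The squares in which the point `p` of the square `s` has the coordinates `wrapPt p`. That this
set only depends on the point of the surface is what separates the points of the surface. -/
def sheets (s : O.Sq) (p : Fin 2 → I) : Set O.Sq :=
  {s' | wrapSq s p = s' ∨ wrapPt p = 0 ∧ O.cornerPerm.SameCycle (wrapSq s p) s'}

theorem sheets_of_wrapPt_eq_zero {s : O.Sq} {p : Fin 2 → I} (h : wrapPt p = 0) :
    sheets s p = {s' | O.cornerPerm.SameCycle (wrapSq s p) s'} := by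
  ext s'
  exact ⟨fun hs => hs.elim (fun hs => hs ▸ .rfl) And.right, fun hs => .inr ⟨h, hs⟩⟩

theorem Glue.wrapPt_eq {q q' : O.Squares} (h : O.Glue q q') : wrapPt q.2 = wrapPt q'.2 := by
  cases h <;> ext i <;> fin_cases i <;> simp [wrapPt]

theorem Glue.sheets_eq {q q' : O.Squares} (h : O.Glue q q') :
    sheets q.1 q.2 = sheets q'.1 q'.2 := by
  have hw := h.wrapPt_eq
  suffices h : wrapSq q.1 q.2 = wrapSq q'.1 q'.2 ∨
      wrapPt q.2 = 0 ∧ O.cornerPerm (wrapSq q.1 q.2) = wrapSq q'.1 q'.2 by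
    rcases h with h | ⟨h0, h⟩
    · simp only [sheets, hw, h]
    · rw [sheets_of_wrapPt_eq_zero h0, sheets_of_wrapPt_eq_zero (hw ▸ h0), ← h]
      simp only [Equiv.Perm.sameCycle_apply_left]
  cases h with
  | right s t => exact .inl (by simp [wrapSq])
  | up s t =>
    by_cases ht : t = 1
    · refine .inr ⟨by ext i; fin_cases i <;> simp [wrapPt, ht], ?_⟩
      simp [wrapSq, ht, cornerPerm_up_right]
    · exact .inl (by simp [wrapSq, ht])

theorem pt_eq_iff {s s' : O.Sq} {p p' : Fin 2 → I} : pt s p = pt s' p' ↔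
    wrapPt p = wrapPt p' ∧ (wrapSq s p = wrapSq s' p' ∨
      wrapPt p = 0 ∧ O.cornerPerm.SameCycle (wrapSq s p) (wrapSq s' p')) := by
  constructor
  · intro h
    refine ⟨congrArg (Quot.lift (fun q : O.Squares => wrapPt q.2) fun _ _ => Glue.wrapPt_eq) h, ?_⟩
    have hsheets : sheets s p = sheets s' p' :=
      congrArg (Quot.lift (fun q : O.Squares => sheets q.1 q.2) fun _ _ => Glue.sheets_eq) h
    change wrapSq s' p' ∈ sheets s p
    exact hsheets ▸ .inl rfl
  · rintro ⟨hp, hs⟩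
    rw [← pt_wrap s, ← pt_wrap s', ← hp]
    rcases hs with hs | ⟨h0, hs⟩
    · rw [hs]
    · rw [h0]
      exact corner_eq_of_sameCycle hs

theorem pt_eq_iff_of_ne {s s' : O.Sq} {p p' : Fin 2 → I} (hp : ∀ i, p i ≠ 1)
    (hp' : ∀ i, p' i ≠ 1) : pt s p = pt s' p' ↔
    p = p' ∧ (s = s' ∨ p = 0 ∧ O.cornerPerm.SameCycle s s') := by
  rw [pt_eq_iff, wrapPt_of_ne hp, wrapPt_of_ne hp', wrapSq_of_ne hp, wrapSq_of_ne hp']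

theorem corner_eq_iff {s s' : O.Sq} : corner s = corner s' ↔ O.cornerPerm.SameCycle s s' := by
  refine ⟨fun h => ?_, corner_eq_of_sameCycle⟩
  obtain rfl | ⟨-, h⟩ := ((pt_eq_iff_of_ne (by simp) (by simp)).1 h).2
  exacts [.rfl, h]

theorem finite_setOf_pt_eq (x : O.Surface) : {q : O.Squares | pt q.1 q.2 = x}.Finite := by
  obtain ⟨s, p, hp, rfl⟩ := exists_eq_pt x
  have hfin : (Set.univ.pi fun i => ({p i, 1} : Set I)).Finite := Set.Finite.pi fun i => by simp
  refine ((Set.finite_univ.prod hfin).image fun z => (⟨z.1, z.2⟩ : O.Squares)).subset ?_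
  rintro ⟨s', p'⟩ h
  refine ⟨(s', p'), ⟨trivial, fun i _ => ?_⟩, rfl⟩
  have hi : wrap (p' i) = p i := by
    rw [← wrapPt_of_ne hp]
    exact congrFun (pt_eq_iff.1 h).1 i
  by_cases h1 : p' i = 1
  · exact .inr h1
  · exact .inl ((wrap_of_ne h1).symm.trans hi)

/-! ### Topology of the surface -/

theorem isQuotientMap_pt : IsQuotientMap fun q : O.Squares => (pt q.1 q.2 : O.Surface) :=
  isQuotientMap_quot_mk

theorem continuous_pt (s : O.Sq) : Continuous (pt s : (Fin 2 → I) → O.Surface) :=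
  isQuotientMap_pt.continuous.comp continuous_sigmaMk

instance : CompactSpace O.Surface := inferInstanceAs (CompactSpace (Quot O.Glue))

theorem continuous_of_forall_pt {Y : Type*} [TopologicalSpace Y] {f : O.Surface → Y}
    (h : ∀ s, Continuous fun p => f (pt s p)) : Continuous f := by
  rw [isQuotientMap_pt.continuous_iff, continuous_sigma_iff]
  exact h

/-- A function on the surface given by a function on each square which is compatible with the
gluings. -/
def lift {Y : Type*} (f : O.Sq → I → I → Y)
    (hr : ∀ s t, f s 1 t = f (O.right s) 0 t) (hu : ∀ s t, f s t 1 = f (O.up s) t 0) :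
    O.Surface → Y :=
  Quot.lift (fun q => f q.1 (q.2 0) (q.2 1)) (by
    intro a b h
    cases h with
    | right s t => exact hr s t
    | up s t => exact hu s t)

@[simp] theorem lift_pt {Y : Type*} (f : O.Sq → I → I → Y) (hr hu) (s : O.Sq) (p : Fin 2 → I) :
    lift f hr hu (pt s p) = f s (p 0) (p 1) := rfl

/-- The projection of the surface to the torus `ℝ² / ℤ²`. -/
def toTorus : O.Surface → Fin 2 → UnitAddCircle :=
  lift (fun _ a b => ![((a : ℝ) : UnitAddCircle), ((b : ℝ) : UnitAddCircle)]) (by simp) (by simp)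

theorem toTorus_pt (s : O.Sq) (p : Fin 2 → I) :
    toTorus (pt s p) = fun i => ((toPlane p i : ℝ) : UnitAddCircle) := by
  ext i
  fin_cases i <;> rfl

theorem continuous_toTorus : Continuous (toTorus : O.Surface → _) :=
  continuous_of_forall_pt fun s => by
    simp only [toTorus_pt, toPlane]
    exact continuous_pi fun i => (AddCircle.continuous_mk' 1).comp (by fun_prop)

theorem coe_eq_coe_iff_wrap {t t' : I} :
    ((t : ℝ) : UnitAddCircle) = ((t' : ℝ) : UnitAddCircle) ↔ wrap t = wrap t' := by
  have coe_wrap (t : I) : ((wrap t : ℝ) : UnitAddCircle) = ((t : ℝ) : UnitAddCircle) := by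
    by_cases h : t = 1
    · rw [h, wrap_one, Set.Icc.coe_zero, Set.Icc.coe_one, AddCircle.coe_period, AddCircle.coe_zero]
    · rw [wrap_of_ne h]
  have wrap_mem (t : I) : (wrap t : ℝ) ∈ Set.Ico (0 : ℝ) (0 + 1) :=
    ⟨(wrap t).2.1, by rw [zero_add]; exact unitInterval.lt_one_iff_ne_one.2 (wrap_ne_one t)⟩
  rw [← coe_wrap t, ← coe_wrap t', AddCircle.coe_eq_coe_iff_of_mem_Ico (wrap_mem t) (wrap_mem t'),
    Subtype.coe_inj]

theorem toTorus_pt_eq_iff {s : O.Sq} {s' : O'.Sq} {p p' : Fin 2 → I} :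
    toTorus (pt s p) = toTorus (pt s' p') ↔ wrapPt p = wrapPt p' := by
  simp only [toTorus_pt, funext_iff, wrapPt, toPlane, coe_eq_coe_iff_wrap]

open Classical in
/-- A continuous function which is positive on the interior of the square `s` and zero elsewhere. -/
def faceBump (s : O.Sq) : O.Surface → ℝ :=
  lift (fun s' a b => (if s' = s then 1 else 0) * ((a : ℝ) * (1 - a) * (b * (1 - b))))
    (by simp) (by simp)

open Classical in
/-- A continuous function which is positive on the open left edge of the square `s` and zero on all
other vertical edges. -/
def leftEdgeBump (s : O.Sq) : O.Surface → ℝ :=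
  lift (fun s' a b => ((if s' = s then 1 else 0) * (1 - (a : ℝ)) +
    (if O.right s' = s then 1 else 0) * a) * ((b : ℝ) * (1 - b)))
    (by simp) (by simp)

open Classical in
/-- A continuous function which is positive on the open lower edge of the square `s` and zero on
all other horizontal edges. -/
def lowerEdgeBump (s : O.Sq) : O.Surface → ℝ :=
  lift (fun s' a b => ((if s' = s then 1 else 0) * (1 - (b : ℝ)) +
    (if O.up s' = s then 1 else 0) * b) * ((a : ℝ) * (1 - a)))
    (by simp) (by simp)

open Classical in
/-- A continuous function which is `1` at the lower left corner of the square `s` and `0` at all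
other vertices: the bilinear interpolation of its values at the vertices. -/
def cornerBump (s : O.Sq) : O.Surface → ℝ :=
  let w : O.Sq → ℝ := fun s' => if O.cornerPerm.SameCycle s s' then 1 else 0
  have hw : ∀ s', w (O.right (O.up s')) = w (O.up (O.right s')) := fun s' => by
    simp only [w, ← cornerPerm_up_right, Equiv.Perm.sameCycle_apply_right]
  lift (fun s' a b => w s' * ((1 - (a : ℝ)) * (1 - b)) + w (O.right s') * (a * (1 - b)) +
    w (O.up s') * ((1 - a) * b) + w (O.up (O.right s')) * (a * b))
    (by intro s t; simp) (by intro s t; simp [hw])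

theorem continuous_faceBump (s : O.Sq) : Continuous (faceBump s) :=
  continuous_of_forall_pt fun s' => by simp only [faceBump, lift_pt]; fun_prop

theorem continuous_leftEdgeBump (s : O.Sq) : Continuous (leftEdgeBump s) :=
  continuous_of_forall_pt fun s' => by simp only [leftEdgeBump, lift_pt]; fun_prop

theorem continuous_lowerEdgeBump (s : O.Sq) : Continuous (lowerEdgeBump s) :=
  continuous_of_forall_pt fun s' => by simp only [lowerEdgeBump, lift_pt]; fun_prop

theorem continuous_cornerBump (s : O.Sq) : Continuous (cornerBump s) :=
  continuous_of_forall_pt fun s' => by simp only [cornerBump, lift_pt]; fun_prop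

/-- The projection to the torus and the bump functions of all squares, which together embed the
surface in a Hausdorff space. -/
def separate (x : O.Surface) : (Fin 2 → UnitAddCircle) × (O.Sq → ℝ × ℝ × ℝ × ℝ) :=
  (toTorus x, fun s => (faceBump s x, leftEdgeBump s x, lowerEdgeBump s x, cornerBump s x))

theorem continuous_separate : Continuous (separate : O.Surface → _) :=
  continuous_toTorus.prodMk <| continuous_pi fun s => (continuous_faceBump s).prodMk <|
    (continuous_leftEdgeBump s).prodMk <|
      (continuous_lowerEdgeBump s).prodMk <| continuous_cornerBump s

theorem injective_separate : Function.Injective (separate : O.Surface → _) := by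
  intro x x' h
  obtain ⟨s, p, hp, rfl⟩ := exists_eq_pt x
  obtain ⟨s', p', hp', rfl⟩ := exists_eq_pt x'
  simp only [separate, Prod.mk.injEq, toTorus_pt_eq_iff, wrapPt_of_ne hp, wrapPt_of_ne hp'] at h
  obtain ⟨rfl, h⟩ := h
  have h := congrFun h s
  simp only [Prod.mk.injEq, faceBump, leftEdgeBump, lowerEdgeBump, cornerBump, lift_pt] at h
  obtain ⟨hface, hleft, hlower, hcorner⟩ := h
  have hne (i : Fin 2) : 1 - (p i : ℝ) ≠ 0 := sub_ne_zero.2 fun hi => hp i (Subtype.ext hi.symm)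
  rw [pt_eq_iff_of_ne hp hp, eq_comm (a := s)]
  refine ⟨rfl, ?_⟩
  by_cases h0 : p 0 = 0 <;> by_cases h1 : p 1 = 0
  · refine .inr ⟨by rw [eq_vecCons p, h0, h1]; simp, ?_⟩
    by_contra hc
    simp [h0, h1, hc, Equiv.Perm.SameCycle.refl] at hcorner
  · exact .inl (by simpa [h0, h1, hne] using hleft)
  · exact .inl (by simpa [h0, h1, hne] using hlower)
  · exact .inl (by simpa [h0, h1, hne] using hface)

instance : T2Space O.Surface := .of_injective_continuous injective_separate continuous_separate

theorem eventually_nhds_of_forall_pt {x : O.Surface} {P : O.Surface → Prop}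
    (h : ∀ s p, pt s p = x → ∀ᶠ q in 𝓝 p, P (pt s q)) : ∀ᶠ y in 𝓝 x, P y := by
  have hfiber := isQuotientMap_pt.continuous.isClosedMap.eventually_nhds_fiber
    (p := fun q : O.Squares => P (pt q.1 q.2)) x (by
      rintro ⟨s, p⟩ hx
      rw [Sigma.nhds_mk, Filter.eventually_map]
      exact h s p hx)
  filter_upwards [hfiber] with y hy
  obtain ⟨q, rfl⟩ := pt_surjective y
  exact hy q rfl

/-! ### Steps inside a square -/

theorem isometry_toPlane : Isometry toPlane :=
  Isometry.piMap (fun _ => Subtype.val) fun _ => isometry_subtype_coe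

theorem norm_toPlane_sub (p q : Fin 2 → I) : ‖toPlane q - toPlane p‖ = dist q p := by
  rw [← dist_eq_norm, isometry_toPlane.dist_eq]

theorem eventually_norm_toPlane_sub_lt (p : Fin 2 → I) {δ : ℝ} (hδ : 0 < δ) :
    ∀ᶠ q in 𝓝 p, ‖toPlane q - toPlane p‖ < δ := by
  simp only [norm_toPlane_sub]
  exact Metric.ball_mem_nhds p hδ

/-- Some square contains points which represent `x` and `y` and differ by the vector `v`. This
describes the translation structure of the surface without using charts, also at the
singularities. -/
def Step (x y : O.Surface) (v : Fin 2 → ℝ) : Prop :=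
  ∃ s p q, pt s p = x ∧ pt s q = y ∧ toPlane q - toPlane p = v

theorem step_pt (s : O.Sq) (p q : Fin 2 → I) :
    Step (pt s p : O.Surface) (pt s q) (toPlane q - toPlane p) := ⟨s, p, q, rfl, rfl, rfl⟩

theorem Step.refl (x : O.Surface) : Step x x 0 := by
  obtain ⟨s, p, -, rfl⟩ := exists_eq_pt x
  simpa using step_pt s p p

theorem Step.toTorus_eq {x y : O.Surface} {v : Fin 2 → ℝ} (h : Step x y v) :
    toTorus y = toTorus x + fun i => (v i : UnitAddCircle) := by
  obtain ⟨s, p, q, rfl, rfl, rfl⟩ := h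
  ext i
  simp [toTorus_pt]

theorem exists_forall_step_of_eventually {x : O.Surface} {R : O.Surface → (Fin 2 → ℝ) → Prop}
    (h : ∀ s p, pt s p = x → ∀ᶠ q in 𝓝 p, R (pt s q) (toPlane q - toPlane p)) :
    ∃ δ > 0, ∀ y v, ‖v‖ < δ → Step x y v → R y v := by
  have hball : ∀ᶠ δ in 𝓝[>] (0 : ℝ), ∀ z ∈ {q : O.Squares | pt q.1 q.2 = x},
      ∀ q, dist q z.2 < δ → R (pt z.1 q) (toPlane q - toPlane z.2) := by
    rw [(finite_setOf_pt_eq x).eventually_all]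
    rintro ⟨s, p⟩ hz
    obtain ⟨ε, hε, hR⟩ := Metric.eventually_nhds_iff.1 (h s p hz)
    filter_upwards [Ioo_mem_nhdsGT hε] with δ hδ q hq
    exact hR (hq.trans hδ.2)
  obtain ⟨δ, hR, hδ⟩ := (hball.and self_mem_nhdsWithin).exists
  refine ⟨δ, hδ, ?_⟩
  rintro _ _ hv ⟨s, p, q, hx, rfl, rfl⟩
  exact hR ⟨s, p⟩ hx q (by rwa [norm_toPlane_sub] at hv)

theorem eventually_exists_step (x : O.Surface) {δ : ℝ} (hδ : 0 < δ) :
    ∀ᶠ y in 𝓝 x, ∃ v, ‖v‖ < δ ∧ Step x y v := by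
  refine eventually_nhds_of_forall_pt ?_
  rintro s p rfl
  filter_upwards [eventually_norm_toPlane_sub_lt p hδ] with q hq
  exact ⟨_, hq, step_pt s p q⟩

theorem exists_forall_exists_sub_eq (t : I) :
    ∃ δ > 0, ∀ v : ℝ, |v| < δ → ∃ a b : I, wrap a = wrap t ∧ (b : ℝ) - a = v := by
  by_cases h : 0 < t ∧ t < 1
  · have h0 : (0 : ℝ) < t := h.1
    have h1 : (t : ℝ) < 1 := h.2
    refine ⟨min t (1 - t), lt_min h0 (by linarith), fun v hv => ?_⟩
    rw [lt_min_iff, abs_lt, abs_lt] at hv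
    exact ⟨t, ⟨t + v, by constructor <;> linarith⟩, rfl, by simp⟩
  · have hwrap : wrap t = 0 := by
      simp only [unitInterval.pos_iff_ne_zero, unitInterval.lt_one_iff_ne_one] at h
      grind [wrap]
    refine ⟨1, one_pos, fun v hv => ?_⟩
    rw [abs_lt] at hv
    rcases le_total 0 v with hv' | hv'
    · exact ⟨0, ⟨v, hv', hv.2.le⟩, by simp [hwrap], by simp⟩
    · exact ⟨1, ⟨1 + v, by linarith, by linarith⟩, by simp [hwrap], by simp⟩

theorem exists_forall_exists_step (x : O.Surface) :
    ∃ δ > 0, ∀ v, ‖v‖ < δ → ∃ y, Step x y v := by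
  obtain ⟨s, p, -, rfl⟩ := exists_eq_pt x
  choose δ hδ h using fun i => exists_forall_exists_sub_eq (p i)
  refine ⟨min (δ 0) (δ 1), lt_min (hδ 0) (hδ 1), fun v hv => ?_⟩
  have hvi (i : Fin 2) : |v i| < δ i :=
    (norm_le_pi_norm v i).trans_lt (hv.trans_le (by fin_cases i <;> simp))
  choose a b ha hb using fun i => h i (v i) (hvi i)
  obtain ⟨s', hs'⟩ := exists_pt_eq_of_wrapPt_eq (s := s) (p := p) (a := a) (funext ha)
  exact ⟨pt s' b, s', a, b, hs', rfl, funext hb⟩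

theorem isCompact_setOf_exists_step (x : O.Surface) (δ : ℝ) :
    IsCompact {y | ∃ v, ‖v‖ ≤ δ ∧ Step x y v} := by
  have hunion : {y | ∃ v, ‖v‖ ≤ δ ∧ Step x y v} = ⋃ z ∈ {q : O.Squares | pt q.1 q.2 = x},
      pt z.1 '' Metric.closedBall z.2 δ := by
    ext y
    simp only [Set.mem_iUnion, Set.mem_ofPred_eq, Set.mem_image, Metric.mem_closedBall]
    constructor
    · rintro ⟨_, hv, s, p, q, hx, rfl, rfl⟩
      exact ⟨⟨s, p⟩, hx, q, by rwa [norm_toPlane_sub] at hv, rfl⟩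
    · rintro ⟨⟨s, p⟩, hx, q, hq, rfl⟩
      exact ⟨_, by rwa [norm_toPlane_sub], s, p, q, hx, rfl, rfl⟩
  rw [hunion]
  exact (finite_setOf_pt_eq x).isCompact_biUnion fun z _ =>
    (isCompact_closedBall z.2 δ).image (continuous_pt z.1)

/-! ### Regular points -/

/-- The point `x` is regular, i.e. nonsingular: no two squares contain `x` at the same coordinates.
This combinatorial condition avoids charts. -/
def IsRegular (x : O.Surface) : Prop :=
  ∀ s s' p, pt s p = x → pt s' p = x → s = s'

theorem coord_cases_of_wrap_eq {a b p q : I} (ha : wrap a = wrap p) (h : (q : ℝ) - p = b - a) :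
    a = p ∧ b = q ∨ a = 0 ∧ b = 0 ∧ p = 1 ∧ q = 1 ∨ a = 1 ∧ b = 1 ∧ p = 0 ∧ q = 0 := by
  have hb := b.2
  have hq := q.2
  rcases wrap_eq_wrap_iff.1 ha with rfl | ⟨rfl, rfl⟩ | ⟨rfl, rfl⟩
  · exact .inl ⟨rfl, Subtype.ext (by linarith)⟩
  · rw [Set.Icc.coe_zero, Set.Icc.coe_one] at h
    exact .inr (.inl ⟨rfl, Subtype.ext (by linarith [hb.1, hq.2, Set.Icc.coe_zero (R := ℝ)]), rfl,
      Subtype.ext (by linarith [hb.1, hq.2, Set.Icc.coe_one (R := ℝ)])⟩)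
  · rw [Set.Icc.coe_zero, Set.Icc.coe_one] at h
    exact .inr (.inr ⟨rfl, Subtype.ext (by linarith [hb.2, hq.1, Set.Icc.coe_one (R := ℝ)]), rfl,
      Subtype.ext (by linarith [hb.2, hq.1, Set.Icc.coe_zero (R := ℝ)])⟩)

theorem exists_pt_eq_and_pt_eq {s : O.Sq} {p q a b : Fin 2 → I} (ha : wrapPt a = wrapPt p)
    (h : toPlane q - toPlane p = toPlane b - toPlane a) :
    ∃ s' : O.Sq, pt s' a = pt s p ∧ pt s' b = pt s q := by
  have hcases (i : Fin 2) := coord_cases_of_wrap_eq (congrFun ha i) (congrFun h i)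
  obtain ⟨s₁, hp, hq⟩ :
      ∃ s₁ : O.Sq, pt s₁ ![a 0, p 1] = pt s p ∧ pt s₁ ![b 0, q 1] = pt s q := by
    rw [eq_vecCons p, eq_vecCons q]
    rcases hcases 0 with ⟨h1, h2⟩ | ⟨h1, h2, h3, h4⟩ | ⟨h1, h2, h3, h4⟩
    · exact ⟨s, by simp [h1], by simp [h2]⟩
    · exact ⟨O.right s, by simp [h1, h3, pt_right], by simp [h2, h4, pt_right]⟩
    · exact ⟨O.right⁻¹ s, by simp [h1, h3, pt_right], by simp [h2, h4, pt_right]⟩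
  rw [← hp, ← hq, eq_vecCons a, eq_vecCons b]
  rcases hcases 1 with ⟨h1, h2⟩ | ⟨h1, h2, h3, h4⟩ | ⟨h1, h2, h3, h4⟩
  · exact ⟨s₁, by simp [h1], by simp [h2]⟩
  · exact ⟨O.up s₁, by simp [h1, h3, pt_up], by simp [h2, h4, pt_up]⟩
  · exact ⟨O.up⁻¹ s₁, by simp [h1, h3, pt_up], by simp [h2, h4, pt_up]⟩

theorem IsRegular.step_unique {x y y' : O.Surface} {v : Fin 2 → ℝ} (hx : IsRegular x)
    (h : Step x y v) (h' : Step x y' v) : y = y' := by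
  obtain ⟨s, p, q, hp, rfl, rfl⟩ := h
  obtain ⟨s', p', q', hp', rfl, hv⟩ := h'
  obtain ⟨s₁, h₁, h₂⟩ := exists_pt_eq_and_pt_eq (s := s) (p := p) (q := q) (a := p') (b := q')
    (pt_eq_iff.1 (hp'.trans hp.symm)).1 hv.symm
  rw [← h₂, hx s₁ s' p' (h₁.trans hp) hp']

theorem isRegular_pt_of_wrapPt_ne_zero {s : O.Sq} {p : Fin 2 → I} (h : wrapPt p ≠ 0) :
    IsRegular (pt s p) := by
  intro s₁ s₂ a h₁ h₂
  have ha : wrapPt a ≠ 0 := (pt_eq_iff.1 h₁).1 ▸ h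
  rcases (pt_eq_iff.1 (h₁.trans h₂.symm)).2 with hs | ⟨h0, -⟩
  · exact (bijective_wrapSq a).1 hs
  · exact absurd h0 ha

theorem isRegular_corner_iff {s : O.Sq} : IsRegular (corner s) ↔ O.cornerPerm s = s := by
  refine ⟨fun h => h _ _ 0 (corner_cornerPerm s) rfl, fun hfix s₁ s₂ p h₁ h₂ => ?_⟩
  have hwrap {s' : O.Sq} (h : pt s' p = corner s) : wrapSq s' p = s := by
    have h := (pt_eq_iff.1 h.symm).2
    rw [wrapSq_of_ne (p := 0) (by simp)] at h
    rcases h with h | ⟨-, h⟩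
    · exact h.symm
    · exact ((h.eq_of_left hfix)).symm
  exact (bijective_wrapSq p).1 ((hwrap h₁).trans (hwrap h₂).symm)

theorem not_isRegular_iff_exists {x : O.Surface} :
    ¬ IsRegular x ↔ ∃ s, O.cornerPerm s ≠ s ∧ x = corner s := by
  constructor
  · intro hx
    obtain ⟨s, p, hp, rfl⟩ := exists_eq_pt x
    obtain rfl : p = 0 := by
      by_contra h0
      exact hx (isRegular_pt_of_wrapPt_ne_zero (by rwa [wrapPt_of_ne hp]))
    exact ⟨s, fun h => hx (isRegular_corner_iff.2 h), rfl⟩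
  · rintro ⟨s, hs, rfl⟩ h
    exact hs (isRegular_corner_iff.1 h)

/-! ### The interior of the square -/

/-- The interior of the unit square, in which the points of the squares are not identified with
other points. -/
def interiorSquare : Set (Fin 2 → I) := Set.univ.pi fun _ => Set.Ioo 0 1

theorem dense_interiorSquare : Dense interiorSquare := dense_pi _ fun i _ => by
  rw [dense_iff_closure_eq, closure_Ioo zero_ne_one]
  exact Set.eq_univ_of_forall fun t => ⟨t.2.1, t.2.2⟩

theorem exists_mem_interiorSquare_of_eventually {p : Fin 2 → I} {P : (Fin 2 → I) → Prop}
    (h : ∀ᶠ q in 𝓝 p, P q) : ∃ q ∈ interiorSquare, P q :=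
  dense_interiorSquare.inter_nhds_nonempty h

theorem ne_one_of_mem_interiorSquare {p : Fin 2 → I} (h : p ∈ interiorSquare) (i : Fin 2) :
    p i ≠ 1 := (h i trivial).2.ne

theorem isRegular_pt_of_mem_Ioo {s : O.Sq} {p : Fin 2 → I} {i : Fin 2} (hp : p i ∈ Set.Ioo 0 1) :
    IsRegular (pt s p) := by
  refine isRegular_pt_of_wrapPt_ne_zero fun h0 => ?_
  have hwrap : wrap (p i) = 0 := congrFun h0 i
  rw [wrap_of_ne hp.2.ne] at hwrap
  exact hp.1.ne' hwrap

theorem isRegular_pt_of_mem_interiorSquare {s : O.Sq} {p : Fin 2 → I} (hp : p ∈ interiorSquare) :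
    IsRegular (pt s p) :=
  isRegular_pt_of_mem_Ioo (hp 0 trivial)

/-! ### Charts and singularities -/

theorem exists_openPartialHomeomorph_of_isCompact {X Y : Type*} [TopologicalSpace X]
    [TopologicalSpace Y] [T2Space Y] {f : X → Y} {K : Set X} {x : X} (hK : IsCompact K)
    (hf : ContinuousOn f K) (hinj : Set.InjOn f K) (hx : K ∈ 𝓝 x) (hfx : f '' K ∈ 𝓝 (f x)) :
    ∃ e : OpenPartialHomeomorph X Y, ⇑e = f ∧ x ∈ e.source ∧ e.source ⊆ K := by
  have : Nonempty X := ⟨x⟩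
  let g := Function.invFunOn f K
  have hgf : Set.LeftInvOn g f K := hinj.leftInvOn_invFunOn
  have hfg {v : Y} (hv : v ∈ f '' K) : f (g v) = v := Function.invFunOn_eq hv
  have hg : ContinuousOn g (f '' K) := by
    refine continuousOn_iff_isClosed.2 fun C hC => ⟨f '' (K ∩ C), ?_, ?_⟩
    · exact ((hK.inter_right hC).image_of_continuousOn (hf.mono Set.inter_subset_left)).isClosed
    · rw [Set.inter_comm K C, hgf.image_inter', Set.inter_assoc, Set.inter_self]
  refine ⟨
    { toFun := f
      invFun := g
      source := interior K ∩ f ⁻¹' interior (f '' K)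
      target := interior (f '' K) ∩ g ⁻¹' interior K
      map_source' := fun y hy => ⟨hy.2, by
        rw [Set.mem_preimage, hgf (interior_subset hy.1)]; exact hy.1⟩
      map_target' := fun v hv => ⟨hv.2, by
        rw [Set.mem_preimage, hfg (interior_subset hv.1)]; exact hv.1⟩
      left_inv' := fun y hy => hgf (interior_subset hy.1)
      right_inv' := fun v hv => hfg (interior_subset hv.1)
      open_source := (hf.mono interior_subset).isOpen_inter_preimage isOpen_interior
        isOpen_interior
      open_target := (hg.mono interior_subset).isOpen_inter_preimage isOpen_interior
        isOpen_interior
      continuousOn_toFun := hf.mono (Set.inter_subset_left.trans interior_subset)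
      continuousOn_invFun := hg.mono (Set.inter_subset_left.trans interior_subset) },
    rfl, ⟨mem_interior_iff_mem_nhds.2 hx, mem_interior_iff_mem_nhds.2 hfx⟩,
    Set.inter_subset_left.trans interior_subset⟩

/-- The representative in `[-1/2, 1/2)` of an element of `ℝ / ℤ`. -/
def circleLift (a : UnitAddCircle) : ℝ := (AddCircle.equivIco 1 (-1 / 2 : ℝ) a : ℝ)

theorem circleLift_coe {v : ℝ} (h : |v| < 1 / 2) : circleLift v = v := by
  rw [abs_lt] at h
  rw [circleLift, AddCircle.equivIco_coe_eq ⟨by linarith, by linarith⟩]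

theorem continuousAt_circleLift {v : ℝ} (h : |v| < 1 / 2) :
    ContinuousAt circleLift (v : UnitAddCircle) := by
  refine continuous_subtype_val.continuousAt.comp (AddCircle.continuousAt_equivIco 1 _ ?_)
  intro heq
  rw [abs_lt] at h
  rw [AddCircle.coe_eq_coe_iff_of_mem_Ico (a := -1 / 2) ⟨by linarith, by linarith⟩
    ⟨by linarith, by linarith⟩] at heq
  linarith

/-- The coordinates of `y` relative to a point `x` near it. -/
def localCoord (x y : O.Surface) : Fin 2 → ℝ := fun i => circleLift (toTorus y i - toTorus x i)

theorem localCoord_of_toTorus_eq {x y : O.Surface} {v : Fin 2 → ℝ}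
    (h : toTorus y = toTorus x + fun i => (v i : UnitAddCircle)) (hv : ‖v‖ < 1 / 2) :
    localCoord x y = v := by
  ext i
  rw [localCoord, h, Pi.add_apply, add_sub_cancel_left,
    circleLift_coe ((norm_le_pi_norm v i).trans_lt hv)]

theorem Step.localCoord_eq {x y : O.Surface} {v : Fin 2 → ℝ} (h : Step x y v)
    (hv : ‖v‖ < 1 / 2) : localCoord x y = v :=
  localCoord_of_toTorus_eq h.toTorus_eq hv

theorem Step.continuousAt_localCoord {x y : O.Surface} {v : Fin 2 → ℝ} (h : Step x y v)
    (hv : ‖v‖ < 1 / 2) : ContinuousAt (localCoord x) y := by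
  refine continuousAt_pi.2 fun i => ?_
  have hdiff : Continuous fun z : O.Surface => toTorus z i - toTorus x i :=
    ((continuous_apply i).comp continuous_toTorus).sub continuous_const
  refine ContinuousAt.comp (f := fun z : O.Surface => toTorus z i - toTorus x i)
    (g := circleLift) ?_ hdiff.continuousAt
  rw [h.toTorus_eq, Pi.add_apply, add_sub_cancel_left]
  exact continuousAt_circleLift ((norm_le_pi_norm v i).trans_lt hv)

theorem isTranslationChart_of_eq_localCoord {x : O.Surface} {δ : ℝ} (hδ : δ < 1 / 4)
    {e : OpenPartialHomeomorph O.Surface (Fin 2 → ℝ)} (he : ⇑e = localCoord x)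
    (hsource : e.source ⊆ {y | ∃ v, ‖v‖ ≤ δ ∧ Step x y v}) : IsTranslationChart e := by
  intro s p hp
  obtain ⟨v, hv, hstep⟩ := hsource hp
  filter_upwards [eventually_norm_toPlane_sub_lt p (show (0 : ℝ) < 1 / 4 by norm_num)] with q hq
  rw [he, hstep.localCoord_eq (by linarith)]
  refine localCoord_of_toTorus_eq ?_ ((norm_add_le _ _).trans_lt (by linarith))
  rw [(step_pt s p q).toTorus_eq, hstep.toTorus_eq]
  ext i
  simp [add_assoc]

theorem IsRegular.exists_chart {x : O.Surface} (hx : IsRegular x) :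
    ∃ e : OpenPartialHomeomorph O.Surface (Fin 2 → ℝ), IsTranslationChart e ∧ x ∈ e.source := by
  obtain ⟨ε, hε, hstep⟩ := exists_forall_exists_step x
  obtain ⟨δ, hδ, hδ'⟩ := exists_between (lt_min hε (show (0 : ℝ) < 1 / 4 by norm_num))
  rw [lt_min_iff] at hδ'
  have hcoord {y v} (h : Step x y v) (hv : ‖v‖ ≤ δ) : localCoord x y = v :=
    h.localCoord_eq (by linarith)
  have himage : localCoord x '' {y | ∃ v, ‖v‖ ≤ δ ∧ Step x y v} = Metric.closedBall 0 δ := by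
    ext v
    rw [mem_closedBall_zero_iff]
    constructor
    · rintro ⟨y, ⟨w, hw, h⟩, rfl⟩
      rwa [hcoord h hw]
    · intro hv
      obtain ⟨y, h⟩ := hstep v (hv.trans_lt hδ'.1)
      exact ⟨y, ⟨v, hv, h⟩, hcoord h hv⟩
  obtain ⟨e, he, hxe, hsource⟩ := exists_openPartialHomeomorph_of_isCompact (f := localCoord x)
    (isCompact_setOf_exists_step x δ)
    (by
      rintro y ⟨v, hv, h⟩
      exact (h.continuousAt_localCoord (by linarith)).continuousWithinAt)
    (by
      rintro y ⟨v, hv, h⟩ y' ⟨v', hv', h'⟩ heq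
      rw [hcoord h hv, hcoord h' hv'] at heq
      exact hx.step_unique h (heq ▸ h'))
    ((eventually_exists_step x hδ).mono fun y ⟨v, hv, h⟩ => ⟨v, hv.le, h⟩)
    (by
      rw [himage, hcoord (.refl x) (by simpa using hδ.le)]
      exact Metric.closedBall_mem_nhds 0 hδ)
  exact ⟨e, isTranslationChart_of_eq_localCoord hδ'.2 he hsource, hxe⟩

theorem IsTranslationChart.isRegular {e : OpenPartialHomeomorph O.Surface (Fin 2 → ℝ)}
    (he : IsTranslationChart e) {x : O.Surface} (hx : x ∈ e.source) : IsRegular x := by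
  rintro s s' p rfl hp'
  have hx' : pt s' p ∈ e.source := hp' ▸ hx
  have hmem (s : O.Sq) (hs : pt s p ∈ e.source) : ∀ᶠ q in 𝓝 p, pt s q ∈ e.source :=
    (continuous_pt s).continuousAt (e.open_source.mem_nhds hs)
  obtain ⟨q, hq, hqs, hqs', heq, heq'⟩ := exists_mem_interiorSquare_of_eventually
    ((hmem s hx).and ((hmem s' hx').and ((he s p hx).and (he s' p hx'))))
  rw [hp', ← heq] at heq'
  exact isRegular_pt_of_mem_interiorSquare hq s s' q rfl (e.injOn hqs' hqs heq')

theorem mem_singularities_iff {x : O.Surface} : x ∈ O.singularities ↔ ¬ IsRegular x :=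
  ⟨fun h hx => let ⟨e, he, hxe⟩ := hx.exists_chart; h e he hxe,
    fun h _ he hxe => h (he.isRegular hxe)⟩

theorem mem_singularities_iff_exists {x : O.Surface} :
    x ∈ O.singularities ↔ ∃ s, O.cornerPerm s ≠ s ∧ x = corner s :=
  mem_singularities_iff.trans not_isRegular_iff_exists

theorem toTorus_corner (s : O.Sq) : toTorus (corner s) = 0 := by
  rw [corner, toTorus_pt]
  ext
  simp [toPlane]

theorem toTorus_eq_zero_of_mem_singularities {x : O.Surface} (h : x ∈ O.singularities) :
    toTorus x = 0 := by
  obtain ⟨s, -, rfl⟩ := mem_singularities_iff_exists.1 h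
  exact toTorus_corner s

theorem finite_singularities : O.singularities.Finite :=
  (Set.finite_range corner).subset fun x hx => by
    obtain ⟨s, -, rfl⟩ := mem_singularities_iff_exists.1 hx
    exact ⟨s, rfl⟩

/-! ### Cone angles -/

open Classical in
/-- The points of the unit square with the same image in the torus as `p ∈ [0, 1)²`. -/
def lifts (p : Fin 2 → I) : Finset (Fin 2 → I) :=
  Fintype.piFinset fun i => if p i = 0 then {0, 1} else {p i}

theorem mem_lifts_iff {p a : Fin 2 → I} (hp : ∀ i, p i ≠ 1) : a ∈ lifts p ↔ wrapPt a = p := by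
  rw [lifts, Fintype.mem_piFinset, funext_iff]
  refine forall_congr' fun i => ?_
  have hpi := hp i
  grind [wrapPt, wrap]

theorem sum_lifts (p : Fin 2 → I) (hp : ∀ i, p i ≠ 1) :
    ∑ a ∈ lifts p, squareAngle a = 2 * Real.pi := by
  classical
  have hprod : ∏ i, ∑ t ∈ (if p i = 0 then {0, 1} else ({p i} : Finset I)),
      (if t = 0 ∨ t = 1 then (1 / 2 : ℝ) else 1) = 1 := by
    refine Finset.prod_eq_one fun i _ => ?_
    split_ifs with h
    · rw [Finset.sum_pair zero_ne_one]
      norm_num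
    · rw [Finset.sum_singleton, if_neg (by simp [h, hp i])]
  simp only [squareAngle, ← Finset.mul_sum, lifts]
  refine (mul_eq_left₀ (by positivity)).2 (Eq.trans ?_ hprod)
  rw [Finset.prod_univ_sum]

theorem coneAngle_pt {s : O.Sq} {p : Fin 2 → I} (hp : ∀ i, p i ≠ 1) :
    coneAngle (pt s p) = {s' : O.Sq | pt s' p = pt s p}.ncard * (2 * Real.pi) := by
  have hwrap {q : O.Squares} (h : wrapPt q.2 = p) : pt (wrapSq q.1 q.2) p = pt q.1 q.2 := by
    rw [← h, pt_wrap]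
  have hlift {q : O.Squares} (h : pt q.1 q.2 = (pt s p : O.Surface)) : wrapPt q.2 = p := by
    rw [(pt_eq_iff.1 h).1, wrapPt_of_ne hp]
  let e : {q : O.Squares // pt q.1 q.2 = (pt s p : O.Surface)} →
      {s' : O.Sq | pt s' p = pt s p} × lifts p := fun q =>
    (⟨wrapSq q.1.1 q.1.2, (hwrap (hlift q.2)).trans q.2⟩, ⟨q.1.2, (mem_lifts_iff hp).2 (hlift q.2)⟩)
  have he : Function.Bijective e := by
    constructor
    · rintro ⟨⟨s₁, a₁⟩, h₁⟩ ⟨⟨s₂, a₂⟩, h₂⟩ h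
      simp only [e, Prod.mk.injEq, Subtype.mk.injEq] at h
      obtain ⟨h, rfl⟩ := h
      obtain rfl := (bijective_wrapSq a₁).1 h
      rfl
    · rintro ⟨⟨s', hs'⟩, ⟨a, ha⟩⟩
      obtain ⟨s', rfl⟩ := (bijective_wrapSq a).2 s'
      exact ⟨⟨⟨s', a⟩, (hwrap (q := ⟨s', a⟩) ((mem_lifts_iff hp).1 ha)).symm.trans hs'⟩, rfl⟩
  have := Fintype.ofFinite {s' : O.Sq | pt s' p = pt s p}
  rw [coneAngle, finsum_eq_of_bijective e he (g := fun z => squareAngle z.2.1) fun _ => rfl,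
    finsum_eq_sum_of_fintype, Fintype.sum_prod_type]
  simp only [Finset.sum_coe_sort (lifts p) squareAngle, sum_lifts p hp]
  rw [Finset.sum_const, Finset.card_univ, nsmul_eq_mul, ← Nat.card_eq_fintype_card,
    Nat.card_coe_set_eq]

theorem IsRegular.coneAngle_eq {x : O.Surface} (hx : IsRegular x) :
    coneAngle x = 2 * Real.pi := by
  obtain ⟨s, p, hp, rfl⟩ := exists_eq_pt x
  have hfiber : {s' | pt s' p = pt s p} = {s} :=
    Set.eq_singleton_iff_unique_mem.2 ⟨rfl, fun s' h => hx s' s p h rfl⟩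
  rw [coneAngle_pt hp, hfiber, Set.ncard_singleton, Nat.cast_one, one_mul]

theorem coneAngle_corner (s : O.Sq) :
    coneAngle (corner s) = {s' | O.cornerPerm.SameCycle s s'}.ncard * (2 * Real.pi) := by
  simp only [← corner_eq_iff, eq_comm (a := corner s)]
  exact coneAngle_pt (by simp)

/-! ### Maps which are affine in the coordinates of the squares -/

/-- Near each point, steps inside squares are mapped to steps inside squares by the matrix `A`.
Unlike `IsAffine`, this also makes sense at the singularities and for maps between different
origamis. -/
def IsStepAffine (f : O.Surface → O'.Surface) (A : Matrix (Fin 2) (Fin 2) ℝ) : Prop :=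
  ∀ x, ∃ δ > 0, ∀ y v, ‖v‖ < δ → Step x y v → Step (f x) (f y) (A *ᵥ v)

theorem IsTranslationChart.exists_forall_step {e : OpenPartialHomeomorph O.Surface (Fin 2 → ℝ)}
    (he : IsTranslationChart e) {x : O.Surface} (hx : x ∈ e.source) :
    ∃ δ > 0, ∀ y v, ‖v‖ < δ → Step x y v → e y = e x + v :=
  exists_forall_step_of_eventually (R := fun y v => e y = e x + v) fun s p h => by
    subst h
    exact he s p hx

theorem IsStepAffine.eventually_eq {f : O.Surface → O'.Surface} {A : Matrix (Fin 2) (Fin 2) ℝ}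
    (hf : IsStepAffine f A) {e : OpenPartialHomeomorph O.Surface (Fin 2 → ℝ)}
    {e' : OpenPartialHomeomorph O'.Surface (Fin 2 → ℝ)} (he : IsTranslationChart e)
    (he' : IsTranslationChart e') {x : O.Surface} (hx : x ∈ e.source) (hx' : f x ∈ e'.source) :
    ∀ᶠ y in 𝓝 x, e' (f y) = e' (f x) + A *ᵥ (e y - e x) := by
  obtain ⟨δ₁, hδ₁, he⟩ := he.exists_forall_step hx
  obtain ⟨δ₂, hδ₂, he'⟩ := he'.exists_forall_step hx'
  obtain ⟨δ₃, hδ₃, hf⟩ := hf x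
  have hA : ∀ᶠ v in 𝓝 (0 : Fin 2 → ℝ), ‖A *ᵥ v‖ < δ₂ :=
    (by fun_prop : Continuous fun v : Fin 2 → ℝ => ‖A *ᵥ v‖).continuousAt.eventually_lt_const
      (by simpa using hδ₂)
  obtain ⟨δ₄, hδ₄, hA⟩ := Metric.eventually_nhds_iff.1 hA
  filter_upwards [eventually_exists_step x (lt_min hδ₁ (lt_min hδ₃ hδ₄))] with y ⟨v, hv, hstep⟩
  rw [lt_min_iff, lt_min_iff] at hv
  rw [he y v hv.1 hstep, add_sub_cancel_left]
  exact he' _ _ (hA (by rw [dist_zero_right]; exact hv.2.2)) (hf y v hv.2.1 hstep)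

theorem IsStepAffine.isLocalTranslation {f : O.Surface → O'.Surface} (hf : IsStepAffine f 1) :
    IsLocalTranslation f := fun e e' he he' x hx hx' => by
  simpa using hf.eventually_eq he he' hx hx'

theorem IsStepAffine.isRegular {f : O.Surface → O'.Surface} {A : Matrix (Fin 2) (Fin 2) ℝ}
    (hf : IsStepAffine f A) (hinj : Function.Injective f) {x : O.Surface}
    (hx : IsRegular (f x)) : IsRegular x := by
  rintro s s' p rfl hp'
  obtain ⟨δ, hδ, hstep⟩ := hf (pt s p)
  obtain ⟨q, hq, hqp⟩ :=
    exists_mem_interiorSquare_of_eventually (eventually_norm_toPlane_sub_lt p hδ)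
  have heq : pt s' q = pt s q := hinj <| hx.step_unique
    (hstep _ _ hqp (hp' ▸ step_pt s' p q)) (hstep _ _ hqp (step_pt s p q))
  exact isRegular_pt_of_mem_interiorSquare hq s s' q rfl heq

/-- There are only finitely many singularities, so a homeomorphism which maps singularities to
singularities permutes them. -/
theorem IsStepAffine.isAffine {f : O.Surface ≃ₜ O.Surface} {A : SL(2, ℝ)}
    (hf : IsStepAffine f A.1) : IsAffine f A := by
  have hsub : f '' O.singularities ⊆ O.singularities := by
    rintro _ ⟨x, hx, rfl⟩
    rw [mem_singularities_iff] at hx ⊢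
    exact fun h => hx (hf.isRegular f.injective h)
  have heq : f '' O.singularities = O.singularities :=
    Set.eq_of_subset_of_ncard_le hsub (Set.ncard_image_of_injective _ f.injective).ge
      finite_singularities
  refine ⟨fun x => ?_, fun e e' he he' x hx hx' => hf.eventually_eq he he' hx hx'⟩
  conv_lhs => rw [← heq]
  exact f.injective.mem_set_image

/-! ### Affine homeomorphisms and the projection to the torus -/

theorem isPreconnected_interiorSquare : IsPreconnected interiorSquare :=
  isPreconnected_univ_pi fun _ => isPreconnected_Ioo

theorem IsAffine.isRegular {f : O.Surface ≃ₜ O.Surface} {A : SL(2, ℝ)} (hf : IsAffine f A)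
    {x : O.Surface} (hx : IsRegular x) : IsRegular (f x) := by
  by_contra h
  exact mem_singularities_iff.1 ((hf.1 x).1 (mem_singularities_iff.2 h)) hx

theorem IsTranslationChart.eventually_toTorus_eq {e : OpenPartialHomeomorph O.Surface (Fin 2 → ℝ)}
    (he : IsTranslationChart e) {x : O.Surface} (hx : x ∈ e.source) :
    ∀ᶠ y in 𝓝 x, toTorus y = toTorus x + fun i => ((e y - e x) i : UnitAddCircle) := by
  obtain ⟨δ, hδ, he⟩ := he.exists_forall_step hx
  filter_upwards [eventually_exists_step x hδ] with y ⟨v, hv, hstep⟩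
  rw [he y v hv hstep, add_sub_cancel_left, hstep.toTorus_eq]

theorem IsAffine.eventually_toTorus_eq {f : O.Surface ≃ₜ O.Surface} {A : SL(2, ℝ)}
    (hf : IsAffine f A) {s : O.Sq} {p : Fin 2 → I} (hp : IsRegular (pt s p)) :
    ∀ᶠ q in 𝓝 p, toTorus (f (pt s q)) = toTorus (f (pt s p)) +
      fun i => ((A.1 *ᵥ (toPlane q - toPlane p)) i : UnitAddCircle) := by
  obtain ⟨e, he, hx⟩ := hp.exists_chart
  obtain ⟨e', he', hx'⟩ := (hf.isRegular hp).exists_chart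
  have hpt := (continuous_pt s).continuousAt (x := p)
  filter_upwards [hpt.eventually (hf.2 e e' he he' _ hx hx'), he s p hx,
    (f.continuous.continuousAt.comp hpt).eventually (he'.eventually_toTorus_eq hx')]
    with q haffine hcoord htorus
  simp only [Function.comp_apply] at htorus
  rw [htorus, haffine, hcoord, add_sub_cancel_left, add_sub_cancel_left]

theorem IsAffine.toTorus_eq {f : O.Surface ≃ₜ O.Surface} {A : SL(2, ℝ)}
    (hf : IsAffine f A) (s : O.Sq) (p q : Fin 2 → I) :
    toTorus (f (pt s q)) = toTorus (f (pt s p)) +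
      fun i => ((A.1 *ᵥ (toPlane q - toPlane p)) i : UnitAddCircle) := by
  let g (q : Fin 2 → I) : Fin 2 → UnitAddCircle :=
    toTorus (f (pt s q)) - fun i => ((A.1 *ᵥ toPlane q) i : UnitAddCircle)
  have hg (p q : Fin 2 → I) : g q = g p ↔ toTorus (f (pt s q)) = toTorus (f (pt s p)) +
      fun i => ((A.1 *ᵥ (toPlane q - toPlane p)) i : UnitAddCircle) := by
    simp only [g, sub_eq_iff_eq_add, mulVec_sub, Pi.sub_apply, AddCircle.coe_sub, ← Pi.sub_def]
    rw [sub_add_eq_add_sub, add_sub_assoc]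
  have hcont : Continuous g := by
    refine (continuous_toTorus.comp (f.continuous.comp (continuous_pt s))).sub
      (continuous_pi fun i => (AddCircle.continuous_mk' 1).comp ?_)
    exact (continuous_apply i).comp
      (continuous_const.matrix_mulVec isometry_toPlane.continuous)
  obtain ⟨c, hc⟩ := dense_interiorSquare.nonempty
  have hconst : ∀ q ∈ interiorSquare, g q = g c := fun q hq =>
    isPreconnected_interiorSquare.induction₂ (fun p q => g q = g p)
      (fun p hp => nhdsWithin_le_nhds <|
        (hf.eventually_toTorus_eq (isRegular_pt_of_mem_interiorSquare (s := s) hp)).mono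
          fun q hq => (hg p q).2 hq)
      (fun _ _ _ _ _ _ h h' => h'.trans h) (fun _ _ _ _ h => h.symm) hc hq
  have hg_const : g = fun _ => g c :=
    Continuous.ext_on dense_interiorSquare hcont continuous_const hconst
  exact (hg p q).1 (by rw [hg_const])

/-! ### Maps over the torus -/

theorem exists_forall_apply_pt_eq {f : O.Surface → O'.Surface} (hf : Continuous f)
    (h : ∀ x, toTorus (f x) = toTorus x) (s : O.Sq) : ∃ s', ∀ p, f (pt s p) = pt s' p := by
  have hsq : ∀ p ∈ interiorSquare, ∃ s', f (pt s p) = pt s' p := fun p hp => by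
    obtain ⟨s', p', hp', heq⟩ := exists_eq_pt (f (pt s p))
    have hp_eq := h (pt s p)
    rw [heq, toTorus_pt_eq_iff, wrapPt_of_ne hp',
      wrapPt_of_ne (ne_one_of_mem_interiorSquare hp)] at hp_eq
    exact ⟨s', hp_eq ▸ heq⟩
  obtain ⟨c, hc⟩ := dense_interiorSquare.nonempty
  have : Nonempty O'.Sq := ⟨(hsq c hc).choose⟩
  choose! k hk using hsq
  have hfs : Continuous fun q => f (pt s q) := hf.comp (continuous_pt s)
  have hloc : ∀ p ∈ interiorSquare, ∀ᶠ q in 𝓝[interiorSquare] p, k q = k p := fun p hp => by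
    have hne : ∀ᶠ q in 𝓝 p, ∀ s', f (pt s p) ≠ pt s' p → f (pt s q) ≠ pt s' q :=
      Filter.eventually_all.2 fun s' => Filter.eventually_imp_distrib_left.2 fun hne =>
        (isOpen_ne_fun hfs (continuous_pt s')).mem_nhds hne
    filter_upwards [nhdsWithin_le_nhds hne, self_mem_nhdsWithin] with q hq hq'
    have heq : f (pt s p) = pt (k q) p := not_imp_not.1 (hq (k q)) (hk q hq')
    exact isRegular_pt_of_mem_interiorSquare hp _ _ p rfl ((hk p hp).symm.trans heq)
  have hconst : ∀ q ∈ interiorSquare, k q = k c := fun q hq =>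
    isPreconnected_interiorSquare.induction₂ (fun p q => k q = k p) hloc
      (fun _ _ _ _ _ _ h h' => h'.trans h) (fun _ _ _ _ h => h.symm) hc hq
  exact ⟨k c, congrFun <| Continuous.ext_on dense_interiorSquare hfs (continuous_pt (k c))
    fun q hq => by rw [hk q hq, hconst q hq]⟩

theorem exists_hom_of_toTorus_eq {f : O.Surface → O'.Surface} (hf : Continuous f)
    (h : ∀ x, toTorus (f x) = toTorus x) : ∃ φ : Hom O O', f = φ.map := by
  choose k hk using exists_forall_apply_pt_eq hf h
  obtain ⟨t, ht⟩ := Set.nonempty_Ioo.2 (zero_lt_one (α := I))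
  have hright (s : O.Sq) : pt (k (O.right s)) ![0, t] = pt (O'.right (k s)) ![0, t] := by
    rw [← hk, ← pt_right, hk, pt_right]
  have hup (s : O.Sq) : pt (k (O.up s)) ![t, 0] = pt (O'.up (k s)) ![t, 0] := by
    rw [← hk, ← pt_up, hk, pt_up]
  refine ⟨⟨k, fun s => ?_, fun s => ?_⟩, ?_⟩
  · exact isRegular_pt_of_mem_Ioo (i := 1) ht _ _ _ rfl (hright s).symm
  · exact isRegular_pt_of_mem_Ioo (i := 0) ht _ _ _ rfl (hup s).symm
  · funext x
    obtain ⟨⟨s, p⟩, rfl⟩ := pt_surjective x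
    exact hk s p

theorem Hom.continuous_map (φ : Hom O O') : Continuous φ.map :=
  continuous_of_forall_pt fun s => continuous_pt (φ.toFun s)

theorem Hom.toTorus_map (φ : Hom O O') (x : O.Surface) : toTorus (φ.map x) = toTorus x := by
  obtain ⟨⟨s, p⟩, rfl⟩ := pt_surjective x
  rfl

theorem Hom.isStepAffine_map (φ : Hom O O') : IsStepAffine φ.map 1 := by
  refine fun x => ⟨1, one_pos, ?_⟩
  rintro _ _ - ⟨s, p, q, rfl, rfl, rfl⟩
  rw [one_mulVec]
  exact step_pt (φ.toFun s) p q

/-! ### Quarter turns and shears of an origami -/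

theorem forall_of_forall_pt {P : O.Surface → Prop} (h : ∀ s a b, P (pt s ![a, b]))
    (x : O.Surface) : P x := by
  obtain ⟨⟨s, p⟩, rfl⟩ := pt_surjective x
  rw [eq_vecCons p]
  exact h s _ _

theorem exists_homeomorph_of_leftInverse {f g : O.Surface → O.Surface} {A : SL(2, ℝ)}
    (hf : Continuous f) (hgf : Function.LeftInverse g f) (hfg : Function.RightInverse g f)
    (hA : IsStepAffine f A.1) : ∃ F : O.Surface ≃ₜ O.Surface, IsAffine F A :=
  ⟨Continuous.homeoOfEquivCompactToT2 (f := ⟨f, g, hgf, hfg⟩) hf, IsStepAffine.isAffine hA⟩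

section Rotation

variable {φ : Equiv.Perm O.Sq} (hright : ∀ s, φ (O.right s) = O.up (φ s))
  (hup : ∀ s, O.right (φ (O.up s)) = φ s)

/-- The map which turns each square `s` by a quarter turn, onto the square `φ s`. -/
def rotate : O.Surface → O.Surface :=
  lift (fun s a b => pt (φ s) ![unitInterval.symm b, a])
    (fun s t => by rw [pt_up, hright]) (fun s t => by simp [pt_right, hup])

/-- The inverse of the map `rotate`. -/
def rotateInv : O.Surface → O.Surface :=
  lift (fun s a b => pt (φ⁻¹ s) ![b, unitInterval.symm a])
    (fun s t => by
      have : O.up (φ⁻¹ (O.right s)) = φ⁻¹ s :=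
        Equiv.Perm.eq_inv_iff_eq.2 (O.right.injective (by simp [hup]))
      rw [unitInterval.symm_one, unitInterval.symm_zero, pt_up, this])
    (fun s t => by
      have : O.right (φ⁻¹ s) = φ⁻¹ (O.up s) :=
        Equiv.Perm.eq_inv_iff_eq.2 (by simp [hright])
      rw [pt_right, this])

theorem continuous_rotate : Continuous (rotate hright hup) :=
  continuous_of_forall_pt fun s => (continuous_pt (φ s)).comp <| continuous_pi <|
    Fin.forall_fin_two.2
      ⟨unitInterval.continuous_symm.comp (continuous_apply 1), continuous_apply 0⟩

theorem isStepAffine_rotate : IsStepAffine (rotate hright hup) !![0, -1; 1, 0] := by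
  refine fun x => ⟨1, one_pos, ?_⟩
  rintro _ _ - ⟨s, p, q, rfl, rfl, rfl⟩
  refine ⟨φ s, ![unitInterval.symm (p 1), p 0], ![unitInterval.symm (q 1), q 0], rfl, rfl, ?_⟩
  ext i
  fin_cases i <;> simp [toPlane, mulVec, vecHead, vecTail]
  ring

include hright hup in
theorem exists_isAffine_rotation :
    ∃ f : O.Surface ≃ₜ O.Surface, IsAffine f ⟨!![0, -1; 1, 0], by simp⟩ :=
  exists_homeomorph_of_leftInverse (g := rotateInv hright hup) (continuous_rotate hright hup)
    (forall_of_forall_pt fun s a b => by simp [rotate, rotateInv])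
    (forall_of_forall_pt fun s a b => by simp [rotate, rotateInv])
    (isStepAffine_rotate hright hup)

end Rotation

section Shear

variable {φ : Equiv.Perm O.Sq} (hright : ∀ s, φ (O.right s) = O.right (φ s))
  (hup : ∀ s, φ (O.up s) = O.up (O.right (φ s)))

open Classical in
/-- The shear `(a, b) ↦ (a + b, b)` of the square `s`, as a map to the squares `φ s` and
`right (φ s)`; the projection to `[0, 1]` is never active, it only serves to avoid a proof that its
argument lies in `[0, 1]`. -/
def shearSq (φ : Equiv.Perm O.Sq) (s : O.Sq) (a b : I) : O.Surface :=
  if (a + b : ℝ) ≤ 1 then pt (φ s) ![Set.projIcc 0 1 zero_le_one (a + b), b]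
  else pt (O.right (φ s)) ![Set.projIcc 0 1 zero_le_one (a + b - 1), b]

open Classical in
/-- The inverse `(a, b) ↦ (a - b, b)` of the shear `shearSq`. -/
def shearInvSq (φ : Equiv.Perm O.Sq) (s : O.Sq) (a b : I) : O.Surface :=
  if (b : ℝ) ≤ a then pt (φ⁻¹ s) ![Set.projIcc 0 1 zero_le_one (a - b), b]
  else pt (φ⁻¹ (O.right⁻¹ s)) ![Set.projIcc 0 1 zero_le_one (a - b + 1), b]

theorem projIcc_eq_of_coe_eq {c : I} {t : ℝ} (h : (c : ℝ) = t) :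
    Set.projIcc 0 1 zero_le_one t = c := by
  rw [← h, Set.projIcc_val]

theorem shearSq_of_coe_eq_add {s : O.Sq} {a b c : I} (h : (c : ℝ) = a + b) :
    shearSq φ s a b = pt (φ s) ![c, b] := by
  rw [shearSq, if_pos (h ▸ c.2.2), projIcc_eq_of_coe_eq h]

theorem shearSq_of_coe_eq_add_sub_one {s : O.Sq} {a b c : I} (h : (c : ℝ) = a + b - 1) :
    shearSq φ s a b = pt (O.right (φ s)) ![c, b] := by
  by_cases hab : (a + b : ℝ) ≤ 1
  · have hc : c = 0 := Subtype.ext (le_antisymm (by rw [h]; simpa using hab) c.2.1)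
    have hab_eq : (a + b : ℝ) = 1 := by rw [hc, Set.Icc.coe_zero] at h; linarith
    rw [shearSq_of_coe_eq_add (c := 1) (by rw [hab_eq, Set.Icc.coe_one]), pt_right, hc]
  · rw [shearSq, if_neg hab, projIcc_eq_of_coe_eq h]

theorem shearInvSq_of_coe_eq_sub {s : O.Sq} {a b c : I} (h : (c : ℝ) = a - b) :
    shearInvSq φ s a b = pt (φ⁻¹ s) ![c, b] := by
  rw [shearInvSq, if_pos (sub_nonneg.1 (h ▸ c.2.1)), projIcc_eq_of_coe_eq h]

include hright in
theorem shearInvSq_of_coe_eq_sub_add_one {s : O.Sq} {a b c : I} (h : (c : ℝ) = a - b + 1) :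
    shearInvSq φ s a b = pt (φ⁻¹ (O.right⁻¹ s)) ![c, b] := by
  by_cases hab : (b : ℝ) ≤ a
  · have hc : c = 1 := Subtype.ext (le_antisymm c.2.2 (by rw [h, Set.Icc.coe_one]; linarith))
    have hab_eq : (a - b : ℝ) = 0 := by rw [hc, Set.Icc.coe_one] at h; linarith
    have hs : O.right (φ⁻¹ (O.right⁻¹ s)) = φ⁻¹ s :=
      Equiv.Perm.eq_inv_iff_eq.2 (by simp [hright])
    rw [shearInvSq_of_coe_eq_sub (c := 0) (by rw [hab_eq, Set.Icc.coe_zero]), hc, pt_right, hs]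
  · rw [shearInvSq, if_neg hab, projIcc_eq_of_coe_eq h]

/-- The shear of the surface with derivative `T`, given on each square by `shearSq`. -/
def shear : O.Surface → O.Surface :=
  lift (shearSq φ)
    (fun s t => by
      rw [shearSq_of_coe_eq_add_sub_one (c := t) (by simp),
        shearSq_of_coe_eq_add (c := t) (by simp), hright])
    (fun s t => by
      rw [shearSq_of_coe_eq_add_sub_one (c := t) (by simp),
        shearSq_of_coe_eq_add (c := t) (by simp), hup, pt_up])

/-- The inverse of the map `shear`. -/
def shearInv : O.Surface → O.Surface :=
  lift (shearInvSq φ)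
    (fun s t => by
      rw [shearInvSq_of_coe_eq_sub (c := unitInterval.symm t) (by simp),
        shearInvSq_of_coe_eq_sub_add_one hright (c := unitInterval.symm t) (by simp; ring)]
      simp)
    (fun s t => by
      have : O.up (φ⁻¹ (O.right⁻¹ s)) = φ⁻¹ (O.up s) :=
        Equiv.Perm.eq_inv_iff_eq.2 (by simp [hup])
      rw [shearInvSq_of_coe_eq_sub_add_one hright (c := t) (by simp),
        shearInvSq_of_coe_eq_sub (c := t) (by simp), pt_up, this])

theorem shear_pt (s : O.Sq) (a b : I) : shear hright hup (pt s ![a, b]) = shearSq φ s a b := rfl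

theorem shearInv_pt (s : O.Sq) (a b : I) :
    shearInv hright hup (pt s ![a, b]) = shearInvSq φ s a b := rfl

theorem leftInverse_shearInv :
    Function.LeftInverse (shearInv hright hup) (shear hright hup) := by
  refine forall_of_forall_pt fun s a b => ?_
  have ha := a.2
  have hb := b.2
  rcases le_total (a + b : ℝ) 1 with h | h
  · rw [shear_pt, shearSq_of_coe_eq_add (c := ⟨a + b, add_nonneg ha.1 hb.1, h⟩) rfl,
      shearInv_pt, shearInvSq_of_coe_eq_sub (c := a) (by simp)]
    simp
  · rw [shear_pt, shearSq_of_coe_eq_add_sub_one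
        (c := ⟨a + b - 1, by linarith, by linarith [ha.2, hb.2]⟩) rfl,
      shearInv_pt, shearInvSq_of_coe_eq_sub_add_one hright (c := a) (by simp; ring)]
    simp

theorem rightInverse_shearInv :
    Function.RightInverse (shearInv hright hup) (shear hright hup) := by
  refine forall_of_forall_pt fun s a b => ?_
  have ha := a.2
  have hb := b.2
  rcases le_total (b : ℝ) a with h | h
  · rw [shearInv_pt, shearInvSq_of_coe_eq_sub
        (c := ⟨a - b, by linarith, by linarith [ha.2, hb.1]⟩) rfl,
      shear_pt, shearSq_of_coe_eq_add (c := a) (by simp)]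
    simp
  · rw [shearInv_pt, shearInvSq_of_coe_eq_sub_add_one hright
        (c := ⟨a - b + 1, by linarith [ha.1, hb.2], by linarith⟩) rfl,
      shear_pt, shearSq_of_coe_eq_add_sub_one (c := a) (by simp; ring)]
    simp

theorem continuous_shearSq (φ : Equiv.Perm O.Sq) (s : O.Sq) :
    Continuous fun p : Fin 2 → I => shearSq φ s (p 0) (p 1) := by
  have hproj (t : O.Sq) {h : (Fin 2 → I) → ℝ} (hh : Continuous h) : Continuous fun p =>
      (pt t ![Set.projIcc 0 1 zero_le_one (h p), p 1] : O.Surface) :=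
    (continuous_pt t).comp <| continuous_pi <|
      Fin.forall_fin_two.2
        ⟨(continuous_projIcc (h := zero_le_one)).comp hh, continuous_apply 1⟩
  refine Continuous.if_le (hproj _ (by fun_prop)) (hproj _ (by fun_prop)) (by fun_prop)
    continuous_const fun p hp => ?_
  rw [projIcc_eq_of_coe_eq (c := 1) (by simp [hp]), projIcc_eq_of_coe_eq (c := 0) (by simp [hp]),
    pt_right]

theorem step_shear_of_add_le_one {s : O.Sq} {p q : Fin 2 → I} (hp : (p 0 + p 1 : ℝ) ≤ 1)
    (hq : (q 0 + q 1 : ℝ) ≤ 1) : Step (shear hright hup (pt s p)) (shear hright hup (pt s q))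
      (!![1, 1; 0, 1] *ᵥ (toPlane q - toPlane p)) := by
  refine ⟨φ s, ![⟨p 0 + p 1, add_nonneg (p 0).2.1 (p 1).2.1, hp⟩, p 1],
    ![⟨q 0 + q 1, add_nonneg (q 0).2.1 (q 1).2.1, hq⟩, q 1],
    (shearSq_of_coe_eq_add rfl).symm, (shearSq_of_coe_eq_add rfl).symm, ?_⟩
  ext i
  fin_cases i <;> simp [toPlane, mulVec, vecHead, vecTail]

theorem step_shear_of_one_le_add {s : O.Sq} {p q : Fin 2 → I} (hp : 1 ≤ (p 0 + p 1 : ℝ))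
    (hq : 1 ≤ (q 0 + q 1 : ℝ)) : Step (shear hright hup (pt s p)) (shear hright hup (pt s q))
      (!![1, 1; 0, 1] *ᵥ (toPlane q - toPlane p)) := by
  refine ⟨O.right (φ s),
    ![⟨p 0 + p 1 - 1, by linarith, by linarith [(p 0).2.2, (p 1).2.2]⟩, p 1],
    ![⟨q 0 + q 1 - 1, by linarith, by linarith [(q 0).2.2, (q 1).2.2]⟩, q 1],
    (shearSq_of_coe_eq_add_sub_one rfl).symm, (shearSq_of_coe_eq_add_sub_one rfl).symm, ?_⟩
  ext i
  fin_cases i <;> simp [toPlane, mulVec, vecHead, vecTail]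

theorem isStepAffine_shear : IsStepAffine (shear hright hup) !![1, 1; 0, 1] := by
  intro x
  refine exists_forall_step_of_eventually (R := fun y v =>
    Step (shear hright hup x) (shear hright hup y) (!![1, 1; 0, 1] *ᵥ v)) ?_
  rintro s p rfl
  have hcont : Continuous fun q : Fin 2 → I => (q 0 + q 1 : ℝ) := by fun_prop
  rcases lt_trichotomy (p 0 + p 1 : ℝ) 1 with h | h | h
  · filter_upwards [hcont.continuousAt.eventually_lt_const h] with q hq
    exact step_shear_of_add_le_one hright hup h.le hq.le
  · refine .of_forall fun q => (le_total (q 0 + q 1 : ℝ) 1).elim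
      (step_shear_of_add_le_one hright hup h.le) (step_shear_of_one_le_add hright hup h.ge)
  · filter_upwards [hcont.continuousAt.eventually_const_lt h] with q hq
    exact step_shear_of_one_le_add hright hup h.le hq.le

include hright hup in
theorem exists_isAffine_shear :
    ∃ f : O.Surface ≃ₜ O.Surface, IsAffine f ⟨!![1, 1; 0, 1], by simp⟩ :=
  exists_homeomorph_of_leftInverse (continuous_of_forall_pt (continuous_shearSq φ))
    (leftInverse_shearInv hright hup) (rightInverse_shearInv hright hup)
    (isStepAffine_shear hright hup)

end Shear

/-! ### Vertices, edges and faces -/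

theorem vertices_eq : O.vertices = Set.range corner := by
  ext x
  constructor
  · rintro ⟨s, p, hp, rfl⟩
    have hwrap : wrapPt p = 0 := funext fun i => by rcases hp i with h | h <;> simp [wrapPt, h]
    exact ⟨wrapSq s p, by rw [← pt_wrap s p, hwrap, corner]⟩
  · rintro ⟨s, rfl⟩
    exact ⟨s, 0, fun i => .inl rfl, rfl⟩

theorem eq_of_wrap_eq {t u : I} (h : wrap t = u) (hu : u ≠ 0) : t = u := by
  by_cases ht : t = 1
  · exact absurd (by rw [← h, ht, wrap_one]) hu
  · rwa [wrap_of_ne ht] at h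

theorem card_faces : O.faces.ncard = Nat.card O.Sq := by
  have hrange : O.faces = Set.range fun s : O.Sq => Set.range (pt s) := by
    ext F
    exact exists_congr fun s => eq_comm
  rw [hrange, ← Nat.card_coe_set_eq]
  refine Nat.card_range_of_injective fun s s' h => ?_
  obtain ⟨m, hm⟩ := dense_interiorSquare.nonempty
  obtain ⟨q, hq⟩ : pt s m ∈ Set.range (pt s') := Set.ext_iff.1 h _ |>.1 ⟨m, rfl⟩
  have hqm : wrapPt q = m := by
    rw [(pt_eq_iff.1 hq).1, wrapPt_of_ne (ne_one_of_mem_interiorSquare hm)]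
  obtain rfl : q = m := funext fun i => eq_of_wrap_eq (congrFun hqm i) (hm i trivial).1.ne'
  exact isRegular_pt_of_mem_interiorSquare hm s s' q rfl hq

/-- The left edge (for `i = 0`) or the lower edge (for `i = 1`) of a square. -/
def lowEdge (z : O.Sq × Fin 2) : Set O.Surface := pt z.1 '' {p | p z.2 = 0}

theorem image_right_edge (s : O.Sq) : pt s '' {p | p 0 = 1} = lowEdge (O.right s, 0) := by
  ext x
  constructor
  · rintro ⟨p, hp : p 0 = 1, rfl⟩
    exact ⟨![0, p 1], rfl, by rw [← pt_right, ← hp, ← eq_vecCons]⟩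
  · rintro ⟨p, hp : p 0 = 0, rfl⟩
    exact ⟨![1, p 1], rfl, by rw [pt_right, ← hp, ← eq_vecCons]⟩

theorem image_upper_edge (s : O.Sq) : pt s '' {p | p 1 = 1} = lowEdge (O.up s, 1) := by
  ext x
  constructor
  · rintro ⟨p, hp : p 1 = 1, rfl⟩
    exact ⟨![p 0, 0], rfl, by rw [← pt_up, ← hp, ← eq_vecCons]⟩
  · rintro ⟨p, hp : p 1 = 0, rfl⟩
    exact ⟨![p 0, 1], rfl, by rw [pt_up, ← hp, ← eq_vecCons]⟩

theorem edges_eq : O.edges = Set.range lowEdge := by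
  ext e
  constructor
  · rintro ⟨s, i, c, rfl | rfl, rfl⟩
    · exact ⟨(s, i), rfl⟩
    · fin_cases i
      · exact ⟨_, (image_right_edge s).symm⟩
      · exact ⟨_, (image_upper_edge s).symm⟩
  · rintro ⟨⟨s, i⟩, rfl⟩
    exact ⟨s, i, 0, .inl rfl, rfl⟩

theorem lowEdge_injective : Function.Injective (lowEdge (O := O)) := by
  rintro ⟨s, i⟩ ⟨s', i'⟩ h
  obtain ⟨m, hm⟩ := Set.nonempty_Ioo.2 (zero_lt_one (α := I))
  let midpoint : Fin 2 → I := fun j => if j = i then 0 else m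
  have hmid_self : midpoint i = 0 := if_pos rfl
  have hmid {j : Fin 2} (hj : j ≠ i) : midpoint j = m := if_neg hj
  have hmid_ne (j : Fin 2) : midpoint j ≠ 1 := by
    by_cases hj : j = i
    · rw [hj, hmid_self]
      exact zero_ne_one
    · rw [hmid hj]
      exact hm.2.ne
  obtain ⟨q, hq : q i' = 0, hqp⟩ : pt s midpoint ∈ lowEdge (s', i') :=
    h ▸ ⟨midpoint, hmid_self, rfl⟩
  have hwrap : wrapPt q = midpoint := by rw [(pt_eq_iff.1 hqp).1, wrapPt_of_ne hmid_ne]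
  obtain rfl : i' = i := by
    by_contra hne
    refine hm.1.ne ?_
    rw [← hmid hne, ← hwrap, wrapPt, hq, wrap_zero]
  obtain rfl : q = midpoint := funext fun j => by
    by_cases hj : j = i'
    · rw [hj, hq, hmid_self]
    · exact eq_of_wrap_eq (congrFun hwrap j) (by rw [hmid hj]; exact hm.1.ne')
  obtain ⟨j, hj⟩ := exists_ne i'
  have hreg : IsRegular (pt s midpoint) := isRegular_pt_of_mem_Ioo (i := j) (by rwa [hmid hj])
  rw [hreg s s' midpoint rfl hqp]

theorem card_edges : O.edges.ncard = 2 * Nat.card O.Sq := by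
  rw [edges_eq, ← Nat.card_coe_set_eq, Nat.card_range_of_injective lowEdge_injective,
    Nat.card_prod, Nat.card_fin, mul_comm]

theorem eulerChar_eq : O.eulerChar = (O.vertices.ncard : ℤ) - Nat.card O.Sq := by
  rw [eulerChar, card_edges, card_faces]
  push_cast
  ring

/-! ### The monodromy group -/

variable (O) in
/-- The monodromy group: the group of permutations of the squares which is generated by the two
gluings. The surface is connected if this group is transitive. -/
def monodromyGroup : Subgroup (Equiv.Perm O.Sq) := Subgroup.closure {O.right, O.up}

theorem apply_mem_orbit_iff {g : Equiv.Perm O.Sq} (hg : g ∈ O.monodromyGroup) {s₀ s : O.Sq} :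
    g s ∈ MulAction.orbit O.monodromyGroup s₀ ↔ s ∈ MulAction.orbit O.monodromyGroup s₀ := by
  rw [← MulAction.orbit_eq_iff, ← MulAction.orbit_eq_iff,
    ← MulAction.orbit_smul (⟨g, hg⟩ : O.monodromyGroup) s]
  rfl

theorem right_mem_orbit_iff {s₀ s : O.Sq} : O.right s ∈ MulAction.orbit O.monodromyGroup s₀ ↔
    s ∈ MulAction.orbit O.monodromyGroup s₀ :=
  apply_mem_orbit_iff (Subgroup.subset_closure (.inl rfl))

theorem up_mem_orbit_iff {s₀ s : O.Sq} : O.up s ∈ MulAction.orbit O.monodromyGroup s₀ ↔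
    s ∈ MulAction.orbit O.monodromyGroup s₀ :=
  apply_mem_orbit_iff (Subgroup.subset_closure (.inr rfl))

section Transitive

variable [MulAction.IsPretransitive O.monodromyGroup O.Sq]

theorem forall_square {P : O.Sq → Prop} (hright : ∀ s, P (O.right s) ↔ P s)
    (hup : ∀ s, P (O.up s) ↔ P s) {s₀ : O.Sq} (h₀ : P s₀) (s : O.Sq) : P s := by
  have hinvariant : ∀ g ∈ O.monodromyGroup, ∀ s, P (g s) ↔ P s := fun g hg => by
    induction hg using Subgroup.closure_induction with
    | mem g hg =>
      rcases hg with rfl | rfl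
      · exact hright
      · exact hup
    | one => exact fun s => Iff.rfl
    | mul g g' _ _ ih ih' => exact fun s => (ih (g' s)).trans (ih' s)
    | inv g _ ih => exact fun s => (ih (g⁻¹ s)).symm.trans (by simp)
  obtain ⟨⟨g, hg⟩, rfl⟩ := MulAction.exists_smul_eq O.monodromyGroup s₀ s
  exact (hinvariant g hg s₀).2 h₀

theorem apply_eq_of_forall_pt {Y : Type*} {f : O.Surface → Y}
    (h : ∀ s p q, f (pt s p) = f (pt s q)) (x y : O.Surface) : f x = f y := by
  obtain ⟨⟨s, p⟩, rfl⟩ := pt_surjective x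
  obtain ⟨⟨s', p'⟩, rfl⟩ := pt_surjective y
  refine forall_square (P := fun s => ∀ p, f (pt s p) = f (pt s' p')) (fun s => ?_) (fun s => ?_)
    (fun p => h s' p p') s p
  · simp only [h s _ ![1, 0], h (O.right s) _ ![0, 0], pt_right]
  · simp only [h s _ ![0, 1], h (O.up s) _ ![0, 0], pt_up]

theorem connectedSpace [Nonempty O.Sq] : ConnectedSpace O.Surface := by
  have : Nonempty O.Surface := .map corner inferInstance
  have : PreconnectedSpace O.Surface := preconnectedSpace_of_forall_constant fun f hf =>
    apply_eq_of_forall_pt fun s => IsLocallyConstant.apply_eq_of_preconnectedSpace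
      ((IsLocallyConstant.iff_continuous _).2 (hf.comp (continuous_pt s)))
  exact ⟨inferInstance⟩

theorem Hom.eq_of_apply_eq {φ ψ : Hom O O'} {s₀ : O.Sq} (h : φ.toFun s₀ = ψ.toFun s₀) :
    φ = ψ := by
  have heq : φ.toFun = ψ.toFun := funext <| forall_square
    (fun s => by rw [φ.map_right, ψ.map_right, O'.right.injective.eq_iff])
    (fun s => by rw [φ.map_up, ψ.map_up, O'.up.injective.eq_iff]) h
  cases φ
  cases ψ
  cases heq
  rfl

theorem IsAffine.toTorus_apply_of_one {f : O.Surface ≃ₜ O.Surface} (hf : IsAffine f 1)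
    (hO : O.singularities.Nonempty) (x : O.Surface) : toTorus (f x) = toTorus x := by
  obtain ⟨y, hy⟩ := hO
  have hconst : toTorus (f x) - toTorus x = toTorus (f y) - toTorus y :=
    apply_eq_of_forall_pt (f := fun x => toTorus (f x) - toTorus x) (fun s p q => by
      rw [hf.toTorus_eq s q p, (step_pt s q p).toTorus_eq]
      simp) x y
  rwa [toTorus_eq_zero_of_mem_singularities hy,
    toTorus_eq_zero_of_mem_singularities ((hf.1 y).2 hy), sub_zero, sub_eq_zero] at hconst

theorem IsAffine.exists_hom_of_one {f : O.Surface ≃ₜ O.Surface} (hf : IsAffine f 1)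
    (hO : O.singularities.Nonempty) : ∃ φ : Hom O O, ⇑f = φ.map :=
  exists_hom_of_toTorus_eq f.continuous (hf.toTorus_apply_of_one hO)

end Transitive

/-! ### Maps respecting the gluings -/

theorem Hom.apply_cornerPerm (φ : Hom O O') (s : O.Sq) :
    φ.toFun (O.cornerPerm s) = O'.cornerPerm (φ.toFun s) := by
  obtain ⟨t, rfl⟩ := O.up.surjective s
  obtain ⟨r, rfl⟩ := O.right.surjective t
  rw [cornerPerm_up_right, φ.map_right, φ.map_up, φ.map_up, φ.map_right, cornerPerm_up_right]

theorem Hom.toFun_eq_of_map_eq {φ ψ : Hom O O'} (h : φ.map = ψ.map) : φ.toFun = ψ.toFun := by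
  obtain ⟨m, hm⟩ := dense_interiorSquare.nonempty
  exact funext fun s =>
    isRegular_pt_of_mem_interiorSquare hm _ _ m rfl (congrFun h (pt s m)).symm

theorem deckGroup_map_le_translationGroup (φ : Hom O O') :
    deckGroup φ.map ≤ O.translationGroup := by
  intro f hf
  obtain ⟨ψ, hψ⟩ : ∃ ψ : Hom O O, ⇑f = ψ.map := exists_hom_of_toTorus_eq f.continuous fun x => by
    rw [← φ.toTorus_map, hf x, φ.toTorus_map]
  exact IsStepAffine.isAffine (A := 1) (hψ ▸ ψ.isStepAffine_map)

theorem Hom.isQuotientMap_map {φ : Hom O O'} (hφ : Function.Surjective φ.map) :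
    IsQuotientMap φ.map :=
  φ.continuous_map.isClosedMap.isQuotientMap φ.continuous_map hφ

theorem exists_modTranslations_homeomorph {φ : Hom O O'} (hφ : Function.Surjective φ.map)
    (hdeck : deckGroup φ.map = O.translationGroup)
    (hnormal : ∀ x y, φ.map x = φ.map y → ∃ f ∈ deckGroup φ.map, f x = y) :
    ∃ Φ : O.ModTranslations ≃ₜ O'.Surface, ∀ x : O.Surface, Φ (Quotient.mk _ x) = φ.map x := by
  rw [hdeck] at hnormal
  let descent : O.ModTranslations → O'.Surface :=
    Quotient.lift φ.map fun x y ⟨f, hf, hxy⟩ => hxy ▸ (hdeck.ge hf x).symm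
  have hbij : Function.Bijective descent := by
    refine ⟨fun x y => Quotient.inductionOn₂ x y fun x y h => Quotient.sound (hnormal x y h), ?_⟩
    exact Function.Surjective.of_comp (g := Quotient.mk _) hφ
  exact ⟨Continuous.homeoOfEquivCompactToT2 (f := Equiv.ofBijective descent hbij)
    (φ.continuous_map.quotient_lift _), fun _ => rfl⟩

/-! ### Veech groups and `SL(2, ℤ)` -/

theorem IsAffine.exists_intCast_eq {f : O.Surface ≃ₜ O.Surface} {A : SL(2, ℝ)}
    (hf : IsAffine f A) {s : O.Sq} {p q : Fin 2 → I} (hp : pt s p ∈ O.singularities)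
    (hq : pt s q ∈ O.singularities) (i : Fin 2) :
    ∃ n : ℤ, (n : ℝ) = (A.1 *ᵥ (toPlane q - toPlane p)) i := by
  have h := congrFun (hf.toTorus_eq s p q) i
  rw [toTorus_eq_zero_of_mem_singularities ((hf.1 _).2 hp),
    toTorus_eq_zero_of_mem_singularities ((hf.1 _).2 hq), zero_add] at h
  obtain ⟨n, hn⟩ := (AddCircle.coe_eq_zero_iff 1).1 h.symm
  exact ⟨n, by simpa using hn⟩

theorem IsAffine.exists_intCast_col_eq {f : O.Surface ≃ₜ O.Surface} {A : SL(2, ℝ)}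
    (hf : IsAffine f A) {s : O.Sq} (hcorner : corner s ∈ O.singularities)
    (hright : corner (O.right s) ∈ O.singularities)
    (hup : corner (O.up (O.right s)) ∈ O.singularities) (i j : Fin 2) :
    ∃ n : ℤ, (n : ℝ) = A.1 i j := by
  have h10 : pt s ![1, 0] ∈ O.singularities := by
    rwa [pt_right, ← show (0 : Fin 2 → I) = ![0, 0] from eq_vecCons 0]
  have h11 : pt s ![1, 1] ∈ O.singularities := by
    rwa [pt_right, pt_up, ← show (0 : Fin 2 → I) = ![0, 0] from eq_vecCons 0]
  fin_cases j
  · simpa [toPlane, mulVec, dotProduct] using hf.exists_intCast_eq hcorner h10 i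
  · simpa [toPlane, mulVec, dotProduct] using hf.exists_intCast_eq h10 h11 i

theorem veechGroup_le_range_map {s : O.Sq} (hcorner : corner s ∈ O.singularities)
    (hright : corner (O.right s) ∈ O.singularities)
    (hup : corner (O.up (O.right s)) ∈ O.singularities) :
    O.veechGroup ≤ (SpecialLinearGroup.map (n := Fin 2) (Int.castRingHom ℝ)).range := by
  rintro A ⟨f, -, hf⟩
  choose a ha using hf.exists_intCast_col_eq hcorner hright hup
  have hA : (Int.castRingHom ℝ).mapMatrix (.of a) = A.1 := ext ha
  have hdet : Int.castRingHom ℝ (det (.of a)) = 1 := by rw [RingHom.map_det, hA, A.2]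
  exact ⟨⟨.of a, Int.cast_injective (α := ℝ) (by simpa using hdet)⟩, Subtype.ext hA⟩

theorem range_map_le_veechGroup {φ ψ : Equiv.Perm O.Sq}
    (hφ_right : ∀ s, φ (O.right s) = O.up (φ s)) (hφ_up : ∀ s, O.right (φ (O.up s)) = φ s)
    (hψ_right : ∀ s, ψ (O.right s) = O.right (ψ s))
    (hψ_up : ∀ s, ψ (O.up s) = O.up (O.right (ψ s))) :
    (SpecialLinearGroup.map (n := Fin 2) (Int.castRingHom ℝ)).range ≤ O.veechGroup := by
  rw [MonoidHom.range_eq_map, ← SpecialLinearGroup.SL2Z_generators, Subgroup.map_le_iff_le_comap,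
    Subgroup.closure_le]
  rintro _ (rfl | rfl)
  · obtain ⟨f, hf⟩ := exists_isAffine_rotation hφ_right hφ_up
    have hS : SpecialLinearGroup.map (Int.castRingHom ℝ) ModularGroup.S =
        ⟨!![0, -1; 1, 0], by simp⟩ := by
      ext i j
      rw [SpecialLinearGroup.map_apply_coe, ModularGroup.coe_S]
      fin_cases i <;> fin_cases j <;> simp
    exact ⟨f, ⟨_, hS ▸ hf⟩, hS ▸ hf⟩
  · obtain ⟨f, hf⟩ := exists_isAffine_shear hψ_right hψ_up
    have hT : SpecialLinearGroup.map (Int.castRingHom ℝ) ModularGroup.T =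
        ⟨!![1, 1; 0, 1], by simp⟩ := by
      ext i j
      rw [SpecialLinearGroup.map_apply_coe, ModularGroup.coe_T]
      fin_cases i <;> fin_cases j <;> simp
    exact ⟨f, ⟨_, hT ▸ hf⟩, hT ▸ hf⟩

end Origami

/-! ### The groups `SL₂` and `PSL₂` -/

section SpecialLinear

open Matrix.SpecialLinearGroup (transvection transvection_add)

theorem mem_center_SL_two_iff {R : Type*} [CommRing R] [NoZeroDivisors R] {g : SL(2, R)} :
    g ∈ Subgroup.center SL(2, R) ↔ g = 1 ∨ g = -1 := by
  constructor
  · rw [Matrix.SpecialLinearGroup.mem_center_iff]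
    rintro ⟨r, hr, h⟩
    rw [Fintype.card_fin, sq_eq_one_iff] at hr
    rcases hr with rfl | rfl
    · exact .inl (Subtype.ext (by rw [← h, map_one]; rfl))
    · exact .inr (Subtype.ext (by rw [← h, map_neg, map_one]; rfl))
  · rintro (rfl | rfl)
    · exact one_mem _
    · exact Subgroup.mem_center_iff.2 fun h => by simp

theorem card_center_SL_two {R : Type*} [CommRing R] [NoZeroDivisors R] (h : (2 : R) ≠ 0) :
    Nat.card (Subgroup.center SL(2, R)) = 2 := by
  have hcoe : (Subgroup.center SL(2, R) : Set SL(2, R)) = {1, -1} :=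
    Set.ext fun _ => mem_center_SL_two_iff
  rw [← SetLike.coe_sort_coe, Nat.card_coe_set_eq, hcoe, Set.ncard_pair]
  intro h1
  have h11 : (1 : R) = -1 := by simpa using congrArg (fun g : SL(2, R) => g.1 0 0) h1
  exact h (by linear_combination h11)

theorem mk_neg_PSL_two {R : Type*} [CommRing R] (g : SL(2, R)) :
    ((-g : SL(2, R)) : PSL(2, R)) = g := by
  refine QuotientGroup.eq.2 (Subgroup.mem_center_iff.2 fun h => ?_)
  rw [inv_neg, neg_mul, inv_mul_cancel]
  simp

theorem card_PSL_two_zmod_three : Nat.card PSL(2, ZMod 3) = 12 := by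
  have hSL : Nat.card SL(2, ZMod 3) = 24 := by
    rw [Nat.card_eq_fintype_card]
    decide +kernel
  have h := Subgroup.card_eq_card_quotient_mul_card_subgroup (Subgroup.center SL(2, ZMod 3))
  rw [card_center_SL_two (by decide), hSL] at h
  change Nat.card (SL(2, ZMod 3) ⧸ Subgroup.center SL(2, ZMod 3)) = 12
  lia

theorem transvection_nsmul {ι R : Type*} [DecidableEq ι] [Fintype ι] [CommRing R] {i j : ι}
    (hij : i ≠ j) (n : ℕ) (b : R) : transvection hij (n • b) = transvection hij b ^ n := by
  induction n with
  | zero => simp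
  | succ n ih => rw [succ_nsmul, transvection_add, ih, pow_succ]

variable {p : ℕ} [Fact p.Prime]

theorem transvection_mem_of_ne_zero {ι : Type*} [DecidableEq ι] [Fintype ι]
    {H : Subgroup (SpecialLinearGroup ι (ZMod p))} {i j : ι} {hij : i ≠ j} {b : ZMod p}
    (hb : b ≠ 0) (h : transvection hij b ∈ H) (c : ZMod p) : transvection hij c ∈ H := by
  have hc : (c / b).val • b = c := by
    rw [nsmul_eq_mul, ZMod.natCast_zmod_val, div_mul_cancel₀ c hb]
  rw [← hc, transvection_nsmul]
  exact H.pow_mem h _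

theorem subgroup_SL_two_eq_top {H : Subgroup SL(2, ZMod p)} {b c : ZMod p} (hb : b ≠ 0)
    (hc : c ≠ 0) (hupper : (transvection zero_ne_one b : SL(2, ZMod p)) ∈ H)
    (hlower : (transvection one_ne_zero c : SL(2, ZMod p)) ∈ H) : H = ⊤ := by
  refine (Subgroup.eq_top_iff' H).2 fun g => SL2.transvection_induction (· ∈ H)
    (fun i j hij d => ?_) (fun _ _ => H.mul_mem) g
  obtain ⟨rfl, rfl⟩ | ⟨rfl, rfl⟩ : i = 0 ∧ j = 1 ∨ i = 1 ∧ j = 0 := by lia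
  · exact transvection_mem_of_ne_zero hb hupper d
  · exact transvection_mem_of_ne_zero hc hlower d

theorem subgroup_PSL_two_eq_top {H : Subgroup PSL(2, ZMod p)} {b c : ZMod p} (hb : b ≠ 0)
    (hc : c ≠ 0) (hupper : (transvection zero_ne_one b : SL(2, ZMod p)) ∈ H.comap
      (QuotientGroup.mk' (Subgroup.center SL(2, ZMod p))))
    (hlower : (transvection one_ne_zero c : SL(2, ZMod p)) ∈ H.comap
      (QuotientGroup.mk' (Subgroup.center SL(2, ZMod p)))) : H = ⊤ :=
  Subgroup.comap_injective (QuotientGroup.mk'_surjective _) <|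
    (subgroup_SL_two_eq_top hb hc hupper hlower).trans (Subgroup.comap_top _).symm

end SpecialLinear

/-! ### Reduction modulo `p` -/

section Reduction

open CongruenceSubgroup
open Matrix.SpecialLinearGroup (map_apply_coe transvection transvection_add transvection_coe
  transvection_coeff_zero transvection_mem_center_iff)

/-- Reduction of the entries, as a map from `PSL(2, ℤ)` to `PSL(2, R)`. -/
def redPSL (R : Type*) [CommRing R] : PSL(2, ℤ) →* PSL(2, R) :=
  QuotientGroup.map _ _ (SpecialLinearGroup.map (Int.castRingHom R)) fun g hg => by
    rcases mem_center_SL_two_iff.1 hg with rfl | rfl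
    · exact one_mem _
    · exact Subgroup.mem_center_iff.2 fun h => by ext; simp

theorem mem_Gamma_mul_iff {m n : ℕ} (hmn : m.Coprime n) {g : SL(2, ℤ)} :
    g ∈ Gamma (m * n) ↔ g ∈ Gamma m ∧ g ∈ Gamma n := by
  have hcast (a b : ℤ) : (a : ZMod (m * n)) = b ↔ (a : ZMod m) = b ∧ (a : ZMod n) = b := by
    simp only [ZMod.intCast_eq_intCast_iff, Nat.cast_mul]
    exact (Int.modEq_and_modEq_iff_modEq_mul (by simpa using hmn)).symm
  have hone (a : ℤ) := hcast a 1
  have hzero (a : ℤ) := hcast a 0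
  simp only [Int.cast_one, Int.cast_zero] at hone hzero
  simp only [Gamma_mem, hone, hzero]
  tauto

theorem neg_mem_Gamma_two {g : SL(2, ℤ)} (hg : g ∈ Gamma 2) : -g ∈ Gamma 2 := by
  rw [Gamma_mem] at hg ⊢
  simpa [ZMod.neg_eq_self_mod_two] using hg

theorem map_matT_sq (R : Type*) [CommRing R] :
    SpecialLinearGroup.map (Int.castRingHom R) (matT ^ 2) = transvection zero_ne_one 2 := by
  have hmat : SpecialLinearGroup.map (Int.castRingHom R) matT = transvection zero_ne_one 1 := by
    ext i j
    rw [map_apply_coe, transvection_coe]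
    fin_cases i <;> fin_cases j <;> simp [matT]
  rw [map_pow, hmat, ← transvection_nsmul, two_nsmul, one_add_one_eq_two]

theorem map_matL_sq (R : Type*) [CommRing R] :
    SpecialLinearGroup.map (Int.castRingHom R) (matL ^ 2) = transvection one_ne_zero 2 := by
  have hmat : SpecialLinearGroup.map (Int.castRingHom R) matL = transvection one_ne_zero 1 := by
    ext i j
    rw [map_apply_coe, transvection_coe]
    fin_cases i <;> fin_cases j <;> simp [matL]
  rw [map_pow, hmat, ← transvection_nsmul, two_nsmul, one_add_one_eq_two]

/-- Reduction modulo `p` on `PΓ₂`. -/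
def redPGamma (p : ℕ) : PGamma 2 →* PSL(2, ZMod p) :=
  (redPSL (ZMod p)).comp (PGamma 2).subtype

variable {p : ℕ} [Fact p.Prime]

theorem redPGamma_surjective (hp : p ≠ 2) : Function.Surjective (redPGamma p) := by
  have h2 : (2 : ZMod p) ≠ 0 := Ring.two_ne_zero (by rwa [ZMod.ringChar_zmod_n])
  refine MonoidHom.range_eq_top.1 (subgroup_PSL_two_eq_top h2 h2 ?_ ?_)
  · exact ⟨⟨_, Subgroup.mem_map_of_mem _ matT_sq_mem⟩, congrArg _ (map_matT_sq (ZMod p))⟩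
  · exact ⟨⟨_, Subgroup.mem_map_of_mem _ matL_sq_mem⟩, congrArg _ (map_matL_sq (ZMod p))⟩

theorem ker_redPGamma (hp : p ≠ 2) :
    (redPGamma p).ker = (PGamma (2 * p)).subgroupOf (PGamma 2) := by
  have hcop : Nat.Coprime 2 p := (Nat.coprime_primes Nat.prime_two Fact.out).2 hp.symm
  ext ⟨x, hx⟩
  rw [MonoidHom.mem_ker, Subgroup.mem_subgroupOf]
  constructor
  · obtain ⟨g, hg, rfl⟩ := hx
    intro h
    rcases mem_center_SL_two_iff.1 ((QuotientGroup.eq_one_iff _).1 h) with h1 | h1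
    · exact Subgroup.mem_map_of_mem _ ((mem_Gamma_mul_iff hcop).2 ⟨hg, h1⟩)
    · refine ⟨-g, (mem_Gamma_mul_iff hcop).2 ⟨neg_mem_Gamma_two hg, ?_⟩, mk_neg_PSL_two g⟩
      have hmap : SpecialLinearGroup.map (Int.castRingHom (ZMod p)) (-g) =
          -SpecialLinearGroup.map (Int.castRingHom (ZMod p)) g := by
        ext
        simp
      exact Gamma_mem'.2 (hmap.trans (by rw [h1, neg_neg]))
  · rintro ⟨g, hg, rfl⟩
    exact congrArg QuotientGroup.mk ((mem_Gamma_mul_iff hcop).1 hg).2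

/-- The isomorphism `PΓ₂ / PΓ₆ ≅ PSL(2, ℤ/3)` given by reduction modulo `3`. -/
def quotEquiv : PGammaQuot ≃* PSL(2, ZMod 3) :=
  have hker : (PGamma 6).subgroupOf (PGamma 2) = (redPGamma 3).ker :=
    (ker_redPGamma (p := 3) (by decide)).symm
  (QuotientGroup.quotientMulEquivOfEq hker).trans
    (QuotientGroup.quotientKerEquivOfSurjective _ (redPGamma_surjective (p := 3) (by decide)))

theorem quotEquiv_clT2 : quotEquiv clT2 = (transvection zero_ne_one 2 : SL(2, ZMod 3)) :=
  congrArg _ (map_matT_sq (ZMod 3))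

theorem quotEquiv_clL2 : quotEquiv clL2 = (transvection one_ne_zero 2 : SL(2, ZMod 3)) :=
  congrArg _ (map_matL_sq (ZMod 3))

theorem card_PGammaQuot : Nat.card PGammaQuot = 12 := by
  rw [Nat.card_congr quotEquiv.toEquiv, card_PSL_two_zmod_three]

theorem clT2_pow_three : clT2 ^ 3 = 1 := by
  refine quotEquiv.injective ?_
  rw [map_pow, quotEquiv_clT2, map_one, ← QuotientGroup.mk_pow, ← transvection_nsmul,
    show 3 • (2 : ZMod 3) = 0 by decide, transvection_coeff_zero, QuotientGroup.mk_one]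

theorem clL2_pow_three : clL2 ^ 3 = 1 := by
  refine quotEquiv.injective ?_
  rw [map_pow, quotEquiv_clL2, map_one, ← QuotientGroup.mk_pow, ← transvection_nsmul,
    show 3 • (2 : ZMod 3) = 0 by decide, transvection_coeff_zero, QuotientGroup.mk_one]

theorem clT2_mul_clL2_sq : (clT2 * clL2) ^ 2 = 1 := by
  refine quotEquiv.injective ?_
  rw [map_pow, map_mul, quotEquiv_clT2, quotEquiv_clL2, map_one, ← QuotientGroup.mk_mul,
    ← QuotientGroup.mk_pow, QuotientGroup.eq_one_iff, mem_center_SL_two_iff]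
  right
  decide

theorem clT2_ne_one : clT2 ≠ 1 := by
  rw [← quotEquiv.map_ne_one_iff, quotEquiv_clT2, Ne, QuotientGroup.eq_one_iff,
    transvection_mem_center_iff]
  decide

theorem clL2_ne_one : clL2 ≠ 1 := by
  rw [← quotEquiv.map_ne_one_iff, quotEquiv_clL2, Ne, QuotientGroup.eq_one_iff,
    transvection_mem_center_iff]
  decide

theorem closure_clT2_clL2 : Subgroup.closure {clT2, clL2} = ⊤ := by
  have htop : (Subgroup.closure {clT2, clL2}).map quotEquiv.toMonoidHom = ⊤ :=
    subgroup_PSL_two_eq_top (by decide : (2 : ZMod 3) ≠ 0) (by decide : (2 : ZMod 3) ≠ 0)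
      ⟨clT2, Subgroup.subset_closure (by simp), quotEquiv_clT2⟩
      ⟨clL2, Subgroup.subset_closure (by simp), quotEquiv_clL2⟩
  exact Subgroup.map_injective quotEquiv.injective
    (htop.trans (Subgroup.map_top_of_surjective _ quotEquiv.surjective).symm)

end Reduction

/-! ### Relations between the classes of `T ^ 2` and `L ^ 2` -/

section TriangleGroup

variable {G : Type*} [Group G] {a b : G}

theorem mul_self_eq_inv_of_pow_three (ha : a ^ 3 = 1) : a * a = a⁻¹ :=
  eq_inv_of_mul_eq_one_left (by rw [← ha, pow_succ, pow_two])

theorem mul_eq_inv_mul_inv_of_sq (hab : (a * b) ^ 2 = 1) : a * b = b⁻¹ * a⁻¹ := by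
  rw [← _root_.mul_inv_rev, eq_inv_iff_mul_eq_one, ← pow_two, hab]

theorem mul_swap_sq_eq_one (hab : (a * b) ^ 2 = 1) : (b * a) ^ 2 = 1 := by
  rw [show b * a = a⁻¹ * (a * b) * a⁻¹⁻¹ by group, conj_pow, hab, mul_one, mul_inv_cancel]

theorem mul_inv_pow_three (ha : a ^ 3 = 1) (hb : b ^ 3 = 1) (hab : (a * b) ^ 2 = 1) :
    (a * b⁻¹) ^ 3 = 1 := by
  have hba : b⁻¹ * a = b * a⁻¹ * b⁻¹ := by
    rw [← mul_self_eq_inv_of_pow_three hb, mul_assoc,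
      mul_eq_inv_mul_inv_of_sq (mul_swap_sq_eq_one hab), mul_assoc, mul_self_eq_inv_of_pow_three hb]
  have ha' : a⁻¹ * a⁻¹ = a := by rw [mul_self_eq_inv_of_pow_three (by simp [ha]), inv_inv]
  have hb' : b⁻¹ * b⁻¹ = b := by rw [mul_self_eq_inv_of_pow_three (by simp [hb]), inv_inv]
  calc
    (a * b⁻¹) ^ 3 = a * (b⁻¹ * a) * (b⁻¹ * a) * b⁻¹ := by
      simp only [pow_succ, pow_zero, one_mul, mul_assoc]
    _ = a * b * (a⁻¹ * a⁻¹) * (b⁻¹ * b⁻¹) := by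
      rw [hba]
      group
    _ = (a * b) ^ 2 := by rw [ha', hb', pow_two, mul_assoc]
    _ = 1 := hab

theorem eq_one_of_pow_three_of_mul_self_sq (ha : a ^ 3 = 1) (haa : (a * a) ^ 2 = 1) : a = 1 :=
  calc
    a = (a * a) ^ 2 * (a ^ 3)⁻¹ := by
      rw [eq_mul_inv_iff_mul_eq, ← pow_succ', ← pow_two, ← pow_mul]
    _ = 1 := by rw [ha, haa, inv_one, one_mul]

end TriangleGroup

theorem clT2_mul_self : clT2 * clT2 = clT2⁻¹ :=
  mul_self_eq_inv_of_pow_three clT2_pow_three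

theorem clL2_mul_self : clL2 * clL2 = clL2⁻¹ :=
  mul_self_eq_inv_of_pow_three clL2_pow_three

theorem clT2_inv_mul_self : clT2⁻¹ * clT2⁻¹ = clT2 := by
  rw [← _root_.mul_inv_rev, clT2_mul_self, inv_inv]

theorem clL2_inv_mul_self : clL2⁻¹ * clL2⁻¹ = clL2 := by
  rw [← _root_.mul_inv_rev, clL2_mul_self, inv_inv]

theorem clT2_mul_clL2 : clT2 * clL2 = clL2⁻¹ * clT2⁻¹ :=
  mul_eq_inv_mul_inv_of_sq clT2_mul_clL2_sq

theorem clL2_mul_clT2 : clL2 * clT2 = clT2⁻¹ * clL2⁻¹ :=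
  mul_eq_inv_mul_inv_of_sq (mul_swap_sq_eq_one clT2_mul_clL2_sq)

theorem clT2_mul_clL2_inv_pow_three : (clT2 * clL2⁻¹) ^ 3 = 1 :=
  mul_inv_pow_three clT2_pow_three clL2_pow_three clT2_mul_clL2_sq

theorem clT2_mul_clL2_inv_ne_one : clT2 * clL2⁻¹ ≠ 1 := fun h =>
  clT2_ne_one <| eq_one_of_pow_three_of_mul_self_sq clT2_pow_three <| by
    simpa only [← mul_inv_eq_one.1 h] using clT2_mul_clL2_sq

/-! ### The vertices of `X` -/

open Origami

/-- The square `(A, h)` of `X`. -/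
def sqX (A : PGammaQuot) (h : Fin 4) : origamiX.Sq := (A, h)

theorem sqX_inj {A A' : PGammaQuot} {h h' : Fin 4} : sqX A h = sqX A' h' ↔ A = A' ∧ h = h' :=
  Prod.mk_inj

theorem exists_eq_sqX (s : origamiX.Sq) : ∃ A h, s = sqX A h := ⟨s.1, s.2, rfl⟩

theorem card_squares_origamiX : Nat.card origamiX.Sq = 48 := by
  change Nat.card (PGammaQuot × Fin 4) = 48
  rw [Nat.card_prod, card_PGammaQuot, Nat.card_fin]

/-- The element of `PΓ₂ / PΓ₆` by which the label `A` of a square `(A, h)` is multiplied when one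
goes once around its lower left corner. -/
def cornerGen : Fin 4 → PGammaQuot
  | 0 => (clT2 * clL2⁻¹)⁻¹
  | 1 => clT2
  | 2 => 1
  | 3 => clL2⁻¹

theorem cornerPerm_sqX (A : PGammaQuot) (h : Fin 4) :
    origamiX.cornerPerm (sqX A h) = sqX (A * cornerGen h) h := by
  match h with
  | 0 =>
    change (A * clT2 * clL2⁻¹ * clT2 * clL2⁻¹, (0 : Fin 4)) = (A * (clT2 * clL2⁻¹)⁻¹, 0)
    rw [← mul_self_eq_inv_of_pow_three clT2_mul_clL2_inv_pow_three]
    simp only [mul_assoc]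
  | 1 =>
    change (A * clT2⁻¹ * clT2⁻¹, (1 : Fin 4)) = (A * clT2, 1)
    rw [mul_assoc, clT2_inv_mul_self]
  | 2 =>
    change (A * clL2⁻¹ * clL2 * clL2⁻¹ * clL2, (2 : Fin 4)) = (A * 1, 2)
    rw [inv_mul_cancel_right, inv_mul_cancel_right, mul_one]
  | 3 =>
    change (A * clL2 * clL2, (3 : Fin 4)) = (A * clL2⁻¹, 3)
    rw [mul_assoc, clL2_mul_self]

theorem orderOf_cornerGen {h : Fin 4} (hh : h ≠ 2) : orderOf (cornerGen h) = 3 := by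
  match h with
  | 0 =>
    exact (orderOf_inv _).trans
      (orderOf_eq_prime clT2_mul_clL2_inv_pow_three clT2_mul_clL2_inv_ne_one)
  | 1 => exact orderOf_eq_prime clT2_pow_three clT2_ne_one
  | 2 => exact absurd rfl hh
  | 3 => exact (orderOf_inv _).trans (orderOf_eq_prime clL2_pow_three clL2_ne_one)

theorem cornerGen_eq_one_iff {h : Fin 4} : cornerGen h = 1 ↔ h = 2 := by
  refine ⟨fun hone => ?_, fun h2 => h2 ▸ rfl⟩
  by_contra hh
  simpa [hone] using orderOf_cornerGen hh

theorem cornerPerm_sqX_eq_iff {A : PGammaQuot} {h : Fin 4} :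
    origamiX.cornerPerm (sqX A h) = sqX A h ↔ h = 2 := by
  rw [cornerPerm_sqX, sqX_inj, mul_eq_left, cornerGen_eq_one_iff, and_iff_left rfl]

theorem cornerPerm_pow_sqX (A : PGammaQuot) (h : Fin 4) (n : ℕ) :
    (origamiX.cornerPerm ^ n) (sqX A h) = sqX (A * cornerGen h ^ n) h := by
  induction n with
  | zero => rw [pow_zero, pow_zero, mul_one, Equiv.Perm.one_apply]
  | succ n ih =>
    rw [pow_succ', Equiv.Perm.mul_apply, ih, cornerPerm_sqX, mul_assoc, ← pow_succ]

theorem sameCycle_sqX_iff {A A' : PGammaQuot} {h h' : Fin 4} :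
    origamiX.cornerPerm.SameCycle (sqX A h) (sqX A' h') ↔
      h = h' ∧ A⁻¹ * A' ∈ Subgroup.zpowers (cornerGen h) := by
  constructor
  · intro hcycle
    obtain ⟨n, -, hn⟩ := hcycle.exists_pow_eq'
    rw [cornerPerm_pow_sqX] at hn
    obtain ⟨rfl, rfl⟩ := sqX_inj.1 hn
    exact ⟨rfl, n, (zpow_natCast _ n).trans (inv_mul_cancel_left _ _).symm⟩
  · rintro ⟨rfl, hmem⟩
    obtain ⟨n, hn : cornerGen h ^ n = A⁻¹ * A'⟩ :=
      (isOfFinOrder_of_finite _).mem_powers_iff_mem_zpowers.2 hmem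
    exact ⟨n, by rw [zpow_natCast, cornerPerm_pow_sqX, hn, mul_inv_cancel_left]⟩

theorem corner_sqX_eq_iff {A A' : PGammaQuot} {h h' : Fin 4} :
    corner (sqX A h) = corner (sqX A' h') ↔
      h = h' ∧ A⁻¹ * A' ∈ Subgroup.zpowers (cornerGen h) :=
  corner_eq_iff.trans sameCycle_sqX_iff

theorem ncard_cornersX (h : Fin 4) : (cornersX h).ncard = 12 / orderOf (cornerGen h) := by
  let cosetCorner : PGammaQuot ⧸ Subgroup.zpowers (cornerGen h) → origamiX.Surface :=
    Quotient.lift (fun A => corner (sqX A h)) fun A A' hA =>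
      corner_sqX_eq_iff.2 ⟨rfl, QuotientGroup.leftRel_apply.1 hA⟩
  have hinj : Function.Injective cosetCorner := fun x y => Quotient.inductionOn₂ x y fun A A' h =>
    QuotientGroup.eq.2 (corner_sqX_eq_iff.1 h).2
  have hrange : cornersX h = Set.range cosetCorner :=
    QuotientGroup.mk_surjective.range_comp cosetCorner
  have hcard := Subgroup.card_eq_card_quotient_mul_card_subgroup (Subgroup.zpowers (cornerGen h))
  rw [card_PGammaQuot, Nat.card_zpowers] at hcard
  rw [hrange, ← Nat.card_coe_set_eq, Nat.card_range_of_injective hinj, hcard,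
    Nat.mul_div_cancel _ (orderOf_pos _)]

theorem ncard_cornersX_of_ne {h : Fin 4} (hh : h ≠ 2) : (cornersX h).ncard = 4 := by
  rw [ncard_cornersX, orderOf_cornerGen hh]

theorem ncard_cornersX_two : (cornersX 2).ncard = 12 := by
  rw [ncard_cornersX, cornerGen_eq_one_iff.2 rfl, orderOf_one]

theorem finite_cornersX (h : Fin 4) : (cornersX h).Finite := Set.finite_range _

theorem disjoint_cornersX {h h' : Fin 4} (hh : h ≠ h') : Disjoint (cornersX h) (cornersX h') := by
  rw [Set.disjoint_left]
  rintro _ ⟨A, rfl⟩ ⟨A', hA⟩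
  exact hh (corner_sqX_eq_iff.1 hA).1.symm

theorem corner_sqX_mem_singularities {A : PGammaQuot} {h : Fin 4} :
    corner (sqX A h) ∈ origamiX.singularities ↔ h ≠ 2 := by
  rw [mem_singularities_iff, isRegular_corner_iff, cornerPerm_sqX_eq_iff]

theorem singularities_origamiX :
    origamiX.singularities = cornersX 0 ∪ cornersX 1 ∪ cornersX 3 := by
  ext x
  constructor
  · intro hx
    obtain ⟨s, -, rfl⟩ := mem_singularities_iff_exists.1 hx
    obtain ⟨A, h, rfl⟩ := exists_eq_sqX s
    match h, corner_sqX_mem_singularities.1 hx with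
    | 0, _ => exact .inl (.inl ⟨A, rfl⟩)
    | 1, _ => exact .inl (.inr ⟨A, rfl⟩)
    | 2, h2 => exact absurd rfl h2
    | 3, _ => exact .inr ⟨A, rfl⟩
  · rintro ((⟨A, rfl⟩ | ⟨A, rfl⟩) | ⟨A, rfl⟩) <;>
      exact corner_sqX_mem_singularities.2 (by decide)

theorem ncard_singularities_origamiX : origamiX.singularities.ncard = 12 := by
  rw [singularities_origamiX,
    Set.ncard_union_eq (Set.disjoint_union_left.2
      ⟨disjoint_cornersX (by decide), disjoint_cornersX (by decide)⟩)
      ((finite_cornersX 0).union (finite_cornersX 1)) (finite_cornersX 3),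
    Set.ncard_union_eq (disjoint_cornersX (by decide)) (finite_cornersX 0) (finite_cornersX 1),
    ncard_cornersX_of_ne (by decide), ncard_cornersX_of_ne (by decide),
    ncard_cornersX_of_ne (by decide)]

theorem vertices_origamiX : origamiX.vertices = origamiX.singularities ∪ cornersX 2 := by
  rw [vertices_eq]
  ext x
  constructor
  · rintro ⟨s, rfl⟩
    obtain ⟨A, h, rfl⟩ := exists_eq_sqX s
    by_cases hh : h = 2
    · exact .inr ⟨A, hh ▸ rfl⟩
    · exact .inl (corner_sqX_mem_singularities.2 hh)
  · rintro (hx | ⟨A, rfl⟩)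
    · obtain ⟨s, -, rfl⟩ := mem_singularities_iff_exists.1 hx
      exact ⟨s, rfl⟩
    · exact ⟨_, rfl⟩

theorem eulerChar_origamiX : origamiX.eulerChar = -24 := by
  have hdisj : Disjoint origamiX.singularities (cornersX 2) := by
    rw [Set.disjoint_right]
    rintro _ ⟨A, rfl⟩ hmem
    exact corner_sqX_mem_singularities.1 hmem rfl
  rw [eulerChar_eq, card_squares_origamiX, vertices_origamiX,
    Set.ncard_union_eq hdisj finite_singularities (finite_cornersX 2),
    ncard_singularities_origamiX, ncard_cornersX_two]
  norm_num

theorem setOf_sameCycle_sqX (A : PGammaQuot) (h : Fin 4) :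
    {s | origamiX.cornerPerm.SameCycle (sqX A h) s} =
      (fun B => sqX (A * B) h) '' (Subgroup.zpowers (cornerGen h) : Set PGammaQuot) := by
  ext s
  obtain ⟨A', h', rfl⟩ := exists_eq_sqX s
  refine sameCycle_sqX_iff.trans ⟨?_, ?_⟩
  · rintro ⟨rfl, hmem⟩
    exact ⟨_, hmem, congrArg (sqX · h) (mul_inv_cancel_left A A')⟩
  · rintro ⟨B, hB, heq⟩
    obtain ⟨rfl, rfl⟩ := sqX_inj.1 heq
    exact ⟨rfl, by rwa [inv_mul_cancel_left]⟩

theorem coneAngle_of_mem_singularities {x : origamiX.Surface} (hx : x ∈ origamiX.singularities) :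
    coneAngle x = 6 * Real.pi := by
  obtain ⟨s, -, rfl⟩ := mem_singularities_iff_exists.1 hx
  obtain ⟨A, h, rfl⟩ := exists_eq_sqX s
  rw [coneAngle_corner, setOf_sameCycle_sqX, Set.ncard_image_of_injective _ fun B B' hB =>
    mul_left_cancel (sqX_inj.1 hB).1, ← Nat.card_coe_set_eq, SetLike.coe_sort_coe,
    Nat.card_zpowers, orderOf_cornerGen (corner_sqX_mem_singularities.1 hx)]
  push_cast
  ring

/-! ### Connectedness of `X` -/

theorem right_right_sqX_zero (A : PGammaQuot) :
    origamiX.right (origamiX.right (sqX A 0)) = sqX (A * clL2⁻¹) 0 := rfl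

theorem up_up_sqX_zero (A : PGammaQuot) :
    origamiX.up (origamiX.up (sqX A 0)) = sqX (A * clL2 * clT2⁻¹) 0 := rfl

theorem sqX_zero_mem_orbit (A : PGammaQuot) :
    sqX A 0 ∈ MulAction.orbit origamiX.monodromyGroup (sqX 1 0) := by
  set R := MulAction.orbit origamiX.monodromyGroup (sqX 1 0)
  have hL (B : PGammaQuot) : sqX (B * clL2) 0 ∈ R ↔ sqX B 0 ∈ R := by
    rw [← right_mem_orbit_iff, ← right_mem_orbit_iff, right_right_sqX_zero, mul_inv_cancel_right]
  have hT (B : PGammaQuot) : sqX (B * clT2) 0 ∈ R ↔ sqX B 0 ∈ R := by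
    rw [← hL, ← hL, mul_assoc _ clL2, clL2_mul_self, ← up_mem_orbit_iff, ← up_mem_orbit_iff,
      up_up_sqX_zero, inv_mul_cancel_right, mul_inv_cancel_right]
  have hA : A ∈ Subgroup.closure {clT2, clL2} := closure_clT2_clL2 ▸ Subgroup.mem_top A
  induction hA using Subgroup.closure_induction_right with
  | one => exact MulAction.mem_orbit_self _
  | mul_right B _ y hy ih =>
    rcases hy with rfl | rfl
    · exact (hT B).2 ih
    · exact (hL B).2 ih
  | mul_inv_cancel B _ y hy ih =>
    rcases hy with rfl | rfl
    · exact (hT _).1 (by rwa [inv_mul_cancel_right])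
    · exact (hL _).1 (by rwa [inv_mul_cancel_right])

instance : MulAction.IsPretransitive origamiX.monodromyGroup origamiX.Sq := by
  refine .of_orbit (x₀ := sqX 1 0) fun s => ?_
  have htwo (A : PGammaQuot) :
      sqX A 2 ∈ MulAction.orbit origamiX.monodromyGroup (sqX 1 0) := by
    rw [← up_mem_orbit_iff]
    exact sqX_zero_mem_orbit _
  obtain ⟨A, h, rfl⟩ := exists_eq_sqX s
  match h with
  | 0 => exact sqX_zero_mem_orbit A
  | 1 => exact right_mem_orbit_iff.2 (sqX_zero_mem_orbit A)
  | 2 => exact htwo A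
  | 3 => exact right_mem_orbit_iff.2 (htwo A)

instance : Nonempty origamiX.Sq := ⟨sqX 1 0⟩

theorem hasGenus_origamiX : origamiX.HasGenus 13 :=
  ⟨connectedSpace, by rw [eulerChar_origamiX]; norm_num⟩

/-! ### Translations of `X` -/

theorem exists_eq_tau (φ : Hom origamiX origamiX) : ∃ B, φ = tau B := by
  obtain ⟨B, h, hB⟩ := exists_eq_sqX (φ.toFun (sqX 1 2))
  obtain rfl : h = 2 := cornerPerm_sqX_eq_iff.1 <| by
    rw [← hB, ← φ.apply_cornerPerm, cornerPerm_sqX_eq_iff.2 rfl]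
  exact ⟨B, Hom.eq_of_apply_eq (hB.trans (congrArg (sqX · 2) (mul_one B).symm))⟩

theorem tau_map_pt (B A : PGammaQuot) (h : Fin 4) (p : Fin 2 → I) :
    (tau B).map (pt (sqX A h) p) = pt (sqX (B * A) h) p := rfl

instance : MulAction PGammaQuot origamiX.Surface where
  smul B x := (tau B).map x
  one_smul x := by
    obtain ⟨⟨⟨A, h⟩, p⟩, rfl⟩ := pt_surjective x
    exact (tau_map_pt 1 A h p).trans (by rw [one_mul]; rfl)
  mul_smul B B' x := by
    obtain ⟨⟨⟨A, h⟩, p⟩, rfl⟩ := pt_surjective x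
    exact (tau_map_pt (B * B') A h p).trans (by rw [mul_assoc]; rfl)

instance : ContinuousConstSMul PGammaQuot origamiX.Surface :=
  ⟨fun B => (tau B).continuous_map⟩

theorem smul_pt_sqX (B A : PGammaQuot) (h : Fin 4) (p : Fin 2 → I) :
    B • (pt (sqX A h) p : origamiX.Surface) = pt (sqX (B * A) h) p := rfl

/-- The homomorphism `B ↦ τ_B` to the group of translations. -/
def tauHom : PGammaQuot →* origamiX.translationGroup where
  toFun B := ⟨Homeomorph.smul B, IsStepAffine.isAffine (A := 1) (tau B).isStepAffine_map⟩
  map_one' := Subtype.ext (Homeomorph.ext (one_smul PGammaQuot))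
  map_mul' B B' := Subtype.ext (Homeomorph.ext (mul_smul B B'))

theorem tauHom_apply (B : PGammaQuot) (x : origamiX.Surface) :
    (tauHom B : origamiX.Surface ≃ₜ origamiX.Surface) x = (tau B).map x := rfl

theorem tauHom_injective : Function.Injective tauHom := by
  intro B B' h
  have hmap : (tau B).map = (tau B').map :=
    congrArg (fun f : origamiX.translationGroup => ⇑(f : origamiX.Surface ≃ₜ origamiX.Surface)) h
  have hsq : sqX (B * 1) 0 = sqX (B' * 1) 0 := congrFun (Hom.toFun_eq_of_map_eq hmap) (sqX 1 0)
  exact mul_right_cancel (sqX_inj.1 hsq).1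

theorem tauHom_surjective : Function.Surjective tauHom := by
  rintro ⟨f, hf : IsAffine f 1⟩
  obtain ⟨φ, hφ⟩ := hf.exists_hom_of_one
    ⟨corner (sqX 1 0), corner_sqX_mem_singularities.2 (by decide)⟩
  obtain ⟨B, rfl⟩ := exists_eq_tau φ
  exact ⟨B, Subtype.ext (DFunLike.coe_injective hφ.symm)⟩

/-- The isomorphism `B ↦ τ_B`. -/
def tauEquiv : PGammaQuot ≃* origamiX.translationGroup :=
  MulEquiv.ofBijective tauHom ⟨tauHom_injective, tauHom_surjective⟩

/-! ### The covering `X → E[2]` -/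

theorem cornerPerm_origamiE2 : origamiE2.cornerPerm = 1 := by
  change rightE2 * upE2 * rightE2⁻¹ * upE2⁻¹ = 1
  decide

/-- The square `h` of `E[2]`. -/
def sqE2 (h : Fin 4) : origamiE2.Sq := h

theorem sqE2_inj {h h' : Fin 4} : sqE2 h = sqE2 h' ↔ h = h' := Iff.rfl

theorem coveringP_map_pt (A : PGammaQuot) (h : Fin 4) (p : Fin 2 → I) :
    coveringP.map (pt (sqX A h) p) = pt (sqE2 h) p := rfl

theorem coveringP_map_smul (B : PGammaQuot) (x : origamiX.Surface) :
    coveringP.map (B • x) = coveringP.map x := by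
  obtain ⟨⟨s, p⟩, rfl⟩ := pt_surjective x
  rfl

theorem coveringP_map_eq_iff {x y : origamiX.Surface} :
    coveringP.map x = coveringP.map y ↔ x ∈ MulAction.orbit PGammaQuot y := by
  refine ⟨fun h => ?_, fun ⟨B, hB⟩ => hB ▸ coveringP_map_smul B y⟩
  obtain ⟨s, p, hp, rfl⟩ := exists_eq_pt x
  obtain ⟨s', p', hp', rfl⟩ := exists_eq_pt y
  obtain ⟨A, k, rfl⟩ := exists_eq_sqX s
  obtain ⟨A', k', rfl⟩ := exists_eq_sqX s'
  rw [coveringP_map_pt, coveringP_map_pt, pt_eq_iff_of_ne hp hp', cornerPerm_origamiE2,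
    Equiv.Perm.sameCycle_one, sqE2_inj] at h
  obtain ⟨rfl, h⟩ := h
  obtain rfl : k = k' := h.elim id And.right
  exact ⟨A * A'⁻¹, (smul_pt_sqX _ _ _ _).trans (by rw [inv_mul_cancel_right])⟩

theorem coveringP_map_surjective : Function.Surjective coveringP.map := by
  intro y
  obtain ⟨⟨h, p⟩, rfl⟩ := pt_surjective y
  exact ⟨pt (sqX 1 h) p, rfl⟩

theorem smul_left_injective_of_notMem {x : origamiX.Surface} (hx : coveringP.map x ∉ pointsPQS) :
    Function.Injective fun B : PGammaQuot => B • x := by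
  intro B B' h
  obtain ⟨s, p, hp, rfl⟩ := exists_eq_pt x
  obtain ⟨A, k, rfl⟩ := exists_eq_sqX s
  dsimp only at h
  rw [smul_pt_sqX, smul_pt_sqX, pt_eq_iff_of_ne hp hp, sqX_inj, sameCycle_sqX_iff] at h
  rcases h.2 with h | ⟨rfl, -, hmem⟩
  · exact mul_right_cancel h.1
  · obtain rfl : k = 2 := by
      by_contra hk
      have hcases : ∀ k : Fin 4, k ≠ 2 → k = 0 ∨ k = 1 ∨ k = 3 := by decide
      exact hx ⟨k, hcases k hk, rfl⟩
    rw [cornerGen_eq_one_iff.2 rfl, Subgroup.zpowers_one_eq_bot, Subgroup.mem_bot,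
      inv_mul_eq_one] at hmem
    exact mul_right_cancel hmem

theorem ncard_fiber_coveringP {y : origamiE2.Surface} (hy : y ∉ pointsPQS) :
    (coveringP.map ⁻¹' {y}).ncard = 12 := by
  obtain ⟨x, rfl⟩ := coveringP_map_surjective y
  have hfiber : coveringP.map ⁻¹' {coveringP.map x} = Set.range fun B : PGammaQuot => B • x :=
    Set.ext fun z => coveringP_map_eq_iff
  rw [hfiber, ← Nat.card_coe_set_eq,
    Nat.card_range_of_injective (smul_left_injective_of_notMem hy), card_PGammaQuot]

theorem isCoveringMapOn_coveringP : IsCoveringMapOn coveringP.map pointsPQSᶜ := by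
  have hquot := Hom.isQuotientMap_map coveringP_map_surjective
  refine (hquot.isCoveringMapOn_of_properlyDiscontinuousSMul (G := PGammaQuot)
    coveringP_map_eq_iff).mono fun y hy => ?_
  obtain ⟨x, rfl⟩ := coveringP_map_surjective y
  refine ⟨x, (Subgroup.eq_bot_iff_forall _).2 fun B hB => ?_, rfl⟩
  exact smul_left_injective_of_notMem hy (hB.trans (one_smul PGammaQuot x).symm)

theorem deckGroup_coveringP : deckGroup coveringP.map = origamiX.translationGroup := by
  refine le_antisymm (deckGroup_map_le_translationGroup coveringP) fun f hf => ?_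
  obtain ⟨B, hB⟩ := tauHom_surjective ⟨f, hf⟩
  obtain rfl : Homeomorph.smul B = f := Subtype.ext_iff.1 hB
  exact coveringP_map_smul B

theorem exists_mem_deckGroup_coveringP {x y : origamiX.Surface}
    (h : coveringP.map x = coveringP.map y) : ∃ f ∈ deckGroup coveringP.map, f x = y := by
  obtain ⟨B, hB⟩ := coveringP_map_eq_iff.1 h.symm
  exact ⟨Homeomorph.smul B, coveringP_map_smul B, hB⟩

/-! ### The Veech group of `X` -/

/-- The permutation of the squares of `X` induced by the quarter turn. -/
def turnSquares : Equiv.Perm (PGammaQuot × Fin 4) where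
  toFun
    | (A, 0) => (A * clT2⁻¹, 2)
    | (A, 1) => (A * clT2, 0)
    | (A, 2) => (A * clT2, 3)
    | (A, 3) => (A * clT2⁻¹, 1)
  invFun
    | (A, 0) => (A * clT2⁻¹, 1)
    | (A, 1) => (A * clT2, 3)
    | (A, 2) => (A * clT2, 0)
    | (A, 3) => (A * clT2⁻¹, 2)
  left_inv := by
    rintro ⟨A, h⟩
    fin_cases h <;> simp
  right_inv := by
    rintro ⟨A, h⟩
    fin_cases h <;> simp

/-- The permutation of the squares of `X` induced by the shear. -/
def shearSquares : Equiv.Perm (PGammaQuot × Fin 4) where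
  toFun
    | (A, 0) => (A * clL2⁻¹, 1)
    | (A, 1) => (A * clL2, 0)
    | (A, 2) => (A * clL2, 2)
    | (A, 3) => (A * clL2, 3)
  invFun
    | (A, 0) => (A * clL2⁻¹, 1)
    | (A, 1) => (A * clL2, 0)
    | (A, 2) => (A * clL2⁻¹, 2)
    | (A, 3) => (A * clL2⁻¹, 3)
  left_inv := by
    rintro ⟨A, h⟩
    fin_cases h <;> simp
  right_inv := by
    rintro ⟨A, h⟩
    fin_cases h <;> simp

theorem turnSquares_right (s : PGammaQuot × Fin 4) :
    turnSquares (rightX s) = upX (turnSquares s) := by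
  obtain ⟨A, h⟩ := s
  match h with
  | 0 =>
    change (A * clT2, (0 : Fin 4)) = (A * clT2⁻¹ * clT2⁻¹, 0)
    rw [mul_assoc, clT2_inv_mul_self]
  | 1 =>
    change (A * clL2⁻¹ * clT2⁻¹, (2 : Fin 4)) = (A * clT2 * clL2, 2)
    rw [mul_assoc, mul_assoc, clT2_mul_clL2]
  | 2 =>
    change (A * clT2⁻¹, (1 : Fin 4)) = (A * clT2 * clT2, 1)
    rw [mul_assoc, clT2_mul_self]
  | 3 =>
    change (A * clL2 * clT2, (3 : Fin 4)) = (A * clT2⁻¹ * clL2⁻¹, 3)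
    rw [mul_assoc, mul_assoc, clL2_mul_clT2]

theorem right_turnSquares_up (s : PGammaQuot × Fin 4) :
    rightX (turnSquares (upX s)) = turnSquares s := by
  obtain ⟨A, h⟩ := s
  match h with
  | 0 =>
    change (A * clL2 * clT2 * clL2, (2 : Fin 4)) = (A * clT2⁻¹, 2)
    rw [mul_assoc (A * clL2), clT2_mul_clL2, ← mul_assoc, mul_inv_cancel_right]
  | 1 =>
    change (A * clL2⁻¹ * clT2⁻¹ * clL2⁻¹, (0 : Fin 4)) = (A * clT2, 0)
    rw [mul_assoc (A * clL2⁻¹), ← clL2_mul_clT2, ← mul_assoc, inv_mul_cancel_right]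
  | 2 =>
    change (A * clT2⁻¹ * clT2⁻¹, (3 : Fin 4)) = (A * clT2, 3)
    rw [mul_assoc, clT2_inv_mul_self]
  | 3 =>
    change (A * clT2 * clT2, (1 : Fin 4)) = (A * clT2⁻¹, 1)
    rw [mul_assoc, clT2_mul_self]

theorem shearSquares_right (s : PGammaQuot × Fin 4) :
    shearSquares (rightX s) = rightX (shearSquares s) := by
  obtain ⟨A, h⟩ := s
  match h with
  | 0 =>
    change (A * clL2, (0 : Fin 4)) = (A * clL2⁻¹ * clL2⁻¹, 0)
    rw [mul_assoc, clL2_inv_mul_self]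
  | 1 =>
    change (A * clL2⁻¹ * clL2⁻¹, (1 : Fin 4)) = (A * clL2, 1)
    rw [mul_assoc, clL2_inv_mul_self]
  | 2 => rfl
  | 3 => rfl

theorem shearSquares_up (s : PGammaQuot × Fin 4) :
    shearSquares (upX s) = upX (rightX (shearSquares s)) := by
  obtain ⟨A, h⟩ := s
  match h with
  | 0 =>
    change (A * clL2 * clL2, (2 : Fin 4)) = (A * clL2⁻¹ * clL2⁻¹ * clL2, 2)
    rw [inv_mul_cancel_right, mul_assoc, clL2_mul_self]
  | 1 =>
    change (A * clL2⁻¹ * clL2, (3 : Fin 4)) = (A * clL2 * clL2⁻¹, 3)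
    rw [inv_mul_cancel_right, mul_inv_cancel_right]
  | 2 =>
    change (A * clT2⁻¹ * clL2⁻¹, (1 : Fin 4)) = (A * clL2 * clT2, 1)
    rw [mul_assoc, mul_assoc, clL2_mul_clT2]
  | 3 =>
    change (A * clT2 * clL2, (0 : Fin 4)) = (A * clL2 * clL2 * clT2⁻¹, 0)
    rw [mul_assoc A clL2, clL2_mul_self, mul_assoc, mul_assoc, clT2_mul_clL2]

theorem veechGroup_origamiX : origamiX.veechGroup =
    (SpecialLinearGroup.map (n := Fin 2) (Int.castRingHom ℝ)).range := by
  refine le_antisymm (veechGroup_le_range_map (s := sqX 1 0) ?_ ?_ ?_)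
    (range_map_le_veechGroup (O := origamiX) turnSquares_right right_turnSquares_up
      shearSquares_right shearSquares_up)
  · exact corner_sqX_mem_singularities.2 (by decide)
  · exact corner_sqX_mem_singularities (A := 1) (h := 1) |>.2 (by decide)
  · exact corner_sqX_mem_singularities (A := 1 * clL2⁻¹) (h := 3) |>.2 (by decide)

end

theorem mainTheorem7 :
    -- `X` is a closed connected surface tiled by 48 squares, and has genus 13
    Nat.card origamiX.Sq = 48 ∧
    CompactSpace origamiX.Surface ∧ T2Space origamiX.Surface ∧
    origamiX.HasGenus 13 ∧
    -- the twelve singularities are the four `P_i`, the four `Q_i` and the four `S_i`; their cone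
    -- angle is `6π`, and all other points have cone angle `2π`
    origamiX.singularities.ncard = 12 ∧
    origamiX.singularities = cornersX 0 ∪ cornersX 1 ∪ cornersX 3 ∧
    (cornersX 0).ncard = 4 ∧ (cornersX 1).ncard = 4 ∧ (cornersX 3).ncard = 4 ∧
    (∀ x ∈ origamiX.singularities, Origami.coneAngle x = 6 * Real.pi) ∧
    (∀ x ∉ origamiX.singularities, Origami.coneAngle x = 2 * Real.pi) ∧
    -- `Trans(X) = {τ_B}`, and `B ↦ τ_B` is an isomorphism from `PΓ₂ / PΓ₆ ≅ PSL₂(ℤ/3)`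
    (∃ e : PGammaQuot ≃* origamiX.translationGroup,
      ∀ (B : PGammaQuot) (x : origamiX.Surface),
        (e B : origamiX.Surface ≃ₜ origamiX.Surface) x = (tau B).map x) ∧
    Nonempty (PGammaQuot ≃* PSL(2, ZMod 3)) ∧
    -- `X / Trans(X) ≅ E[2]`, by the map induced by `p`, which is a local translation
    (∃ Φ : origamiX.ModTranslations ≃ₜ origamiE2.Surface,
      ∀ x : origamiX.Surface, Φ (Quotient.mk _ x) = coveringP.map x) ∧
    Origami.IsLocalTranslation coveringP.map ∧
    -- `p : X → E[2]` is a covering outside of the points `P`, `Q`, `S` of `E[2]`, of degree 12,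
    -- and it is normal with group of deck transformations `Trans(X) ≅ PΓ₂ / PΓ₆`
    IsCoveringMapOn coveringP.map pointsPQSᶜ ∧
    (∀ y ∉ pointsPQS, (coveringP.map ⁻¹' {y}).ncard = 12) ∧
    deckGroup coveringP.map = origamiX.translationGroup ∧
    (∀ x y : origamiX.Surface, coveringP.map x = coveringP.map y →
      ∃ f ∈ deckGroup coveringP.map, f x = y) ∧
    -- the Veech group is `SL₂(ℤ)`
    origamiX.veechGroup =
      (Matrix.SpecialLinearGroup.map (n := Fin 2) (Int.castRingHom ℝ)).range := by
  refine ⟨card_squares_origamiX, inferInstance, inferInstance, hasGenus_origamiX,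
    ncard_singularities_origamiX, singularities_origamiX, ncard_cornersX_of_ne (by decide),
    ncard_cornersX_of_ne (by decide), ncard_cornersX_of_ne (by decide),
    fun _ hx => coneAngle_of_mem_singularities hx, fun _ hx => ?_,
    ⟨tauEquiv, tauHom_apply⟩, ⟨quotEquiv⟩, ?_,
    coveringP.isStepAffine_map.isLocalTranslation, isCoveringMapOn_coveringP,
    fun _ hy => ncard_fiber_coveringP hy, deckGroup_coveringP,
    fun _ _ h => exists_mem_deckGroup_coveringP h, veechGroup_origamiX⟩
  · exact (not_not.1 fun h => hx (Origami.mem_singularities_iff.2 h)).coneAngle_eq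
  · exact Origami.exists_modTranslations_homeomorph coveringP_map_surjective deckGroup_coveringP
      fun _ _ => exists_mem_deckGroup_coveringP
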